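/- Let $U\subseteq\mathbb R^2$ be a nonempty connected open set and let $\mathfrak g$ be a four-dimensional real Lie algebra of real-analytic vector fields on $U$. For a Lie algebra of vector fields on an open set $M$, the orbit of a point is the set of points reached from it along finitely many successive integral curves (inside $M$) of fields of the algebra; the algebra is said to have $r$-dimensional generic orbits, with set of generic points $W$, if $W\subseteq M$ is open and nonempty, the orbits of the points of $W$ have dimension $r$, and the orbits of all other points have dimension $<r$; the number $r$ is its rank. Assume that $\mathfrak g$ has rank $1$, that $\mathfrak g'=[\mathfrak g,\mathfrak g]$ is abelian, and that some element of $\mathfrak g/\mathfrak g'$ acts on $\mathfrak g'$ with a nonzero real eigenvalue of (algebraic) multiplicity $3$. (a) Then $\dim\mathfrak g'=3$, and for every basis $v_1,v_2,v_3$ of $\mathfrak g'$ there is a dense open subset of $U$ such that near each of its points there are analytic coordinates $(x,y)$ and an analytic function $\phi(x)$, with $\phi''$ nowhere zero, in which $v_1=\partial_y$, $v_2=x\,\partial_y$, $v_3=\phi(x)\,\partial_y$, and $$\mathfrak g'=\langle \partial_y,\;x\,\partial_y,\;\phi(x)\,\partial_y\rangle,\qquad \mathfrak g=\langle y\,\partial_y,\;\partial_y,\;x\,\partial_y,\;\phi(x)\,\partial_y\rangle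 .$$ Now let $(x,y)$ be any analytic coordinates on a nonempty open subset of $U$, with values in the open set $V\subseteq\mathbb R^2$, in which $\mathfrak g'$ and $\mathfrak g$ have this form for an analytic function $\phi$ of $x$ with $\phi''$ nowhere zero, and consider the third prolongation of $\mathfrak g$ on the space of jets $(x,y,y',y'',y''')$ with $(x,y)\in V$. (b) The generic orbits of the prolonged algebra are four-dimensional, and the set of generic points is exactly the complement of the set $y''\phi'''-\phi''y'''=0$. (c) $y'''=\dfrac{\phi'''}{\phi''}\,y''$ is the unique invariant hypersurface of the form $y'''=f(x,y,y',y'')$. More precisely, for every open set $D$ of jets $(x,y,y',y'')$ with $(x,y)\in V$ and every function $f:D\to\mathbb R$, the hypersurface $y'''=f(x,y,y',y'')$ over $D$ is invariant under the prolonged algebra (that is, a union of its orbits in $D\times\mathbb R$) if and only if $f(x,y,y',y'')=\dfrac{\phi'''(x)}{\phi''(x)}\,y''$ on $D$. -/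

import Mathlib

open Set

/-- The plane, with coordinates `(x, y)`. -/
abbrev Plane : Type := ℝ × ℝ

/-! ### Lie algebras of analytic vector fields on an open set of the plane -/

/-- The real vector space of (real-)analytic vector fields on the open set `U`. A vector field is
recorded as a function on the plane that is analytic on `U` and `0` outside `U`, so that two of
them are equal exactly when they agree on `U`. -/
def analyticFields (U : TopologicalSpace.Opens Plane) : Submodule ℝ (Plane → Plane) where
  carrier := {X | AnalyticOnNhd ℝ X U ∧ ∀ z ∉ U, X z = 0}
  add_mem' := fun {X Y} hX hY =>
    ⟨hX.1.add hY.1, fun z hz => by simp [hX.2 z hz, hY.2 z hz]⟩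
  zero_mem' := ⟨fun _ _ => analyticAt_const, fun _ _ => rfl⟩
  smul_mem' := fun c X hX =>
    ⟨fun z hz => (hX.1 z hz).const_smul, fun z hz => by simp [hX.2 z hz]⟩

/-- The type of analytic vector fields on `U`. -/
def AnalyticVF (U : TopologicalSpace.Opens Plane) : Type := analyticFields U

namespace AnalyticVF

variable {U : TopologicalSpace.Opens Plane}

noncomputable instance : AddCommGroup (AnalyticVF U) :=
  inferInstanceAs (AddCommGroup (analyticFields U))

noncomputable instance : Module ℝ (AnalyticVF U) :=
  inferInstanceAs (Module ℝ (analyticFields U))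

instance : CoeFun (AnalyticVF U) (fun _ => Plane → Plane) := ⟨fun X => X.1⟩

theorem ext_on {X Y : AnalyticVF U} (h : ∀ z ∈ U, X z = Y z) : X = Y := by
  apply Subtype.ext
  funext z
  by_cases hz : z ∈ U
  · exact h z hz
  · rw [X.2.2 z hz, Y.2.2 z hz]

theorem analyticAt (X : AnalyticVF U) {z : Plane} (hz : z ∈ U) : AnalyticAt ℝ (⇑X) z :=
  X.2.1 z hz

theorem coe_add (X Y : AnalyticVF U) : (⇑(X + Y) : Plane → Plane) = ⇑X + ⇑Y := rfl

theorem coe_smul (c : ℝ) (X : AnalyticVF U) : (⇑(c • X) : Plane → Plane) = c • ⇑X := rfl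

theorem coe_zero : (⇑(0 : AnalyticVF U) : Plane → Plane) = 0 := rfl

theorem analyticOnNhd_lieBracket (X Y : AnalyticVF U) :
    AnalyticOnNhd ℝ (VectorField.lieBracket ℝ (⇑X) (⇑Y)) U := fun _ hz =>
  ((ContinuousLinearMap.analyticAt_bilinear (ContinuousLinearMap.id ℝ (Plane →L[ℝ] Plane))
      _).comp₂ (Y.analyticAt hz).fderiv (X.analyticAt hz)).sub
    ((ContinuousLinearMap.analyticAt_bilinear (ContinuousLinearMap.id ℝ (Plane →L[ℝ] Plane))
      _).comp₂ (X.analyticAt hz).fderiv (Y.analyticAt hz))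

/-- The commutator of vector fields, `[X, Y] = DY · X - DX · Y`, on `U`. -/
noncomputable instance : Bracket (AnalyticVF U) (AnalyticVF U) where
  bracket X Y := ⟨(U : Set Plane).indicator (VectorField.lieBracket ℝ (⇑X) (⇑Y)),
    ⟨(analyticOnNhd_lieBracket X Y).congr U.isOpen
      (fun _ hz => (indicator_of_mem hz _).symm), fun _ hz => indicator_of_notMem hz _⟩⟩

theorem lie_apply (X Y : AnalyticVF U) {z : Plane} (hz : z ∈ U) :
    (⁅X, Y⁆ : AnalyticVF U) z = VectorField.lieBracket ℝ (⇑X) (⇑Y) z :=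
  indicator_of_mem (s := (U : Set Plane)) hz _

theorem lie_eventuallyEq (X Y : AnalyticVF U) {z : Plane} (hz : z ∈ U) :
    (⇑(⁅X, Y⁆ : AnalyticVF U)) =ᶠ[nhds z] VectorField.lieBracket ℝ (⇑X) (⇑Y) := by
  filter_upwards [U.isOpen.mem_nhds hz] with w hw using lie_apply X Y hw

noncomputable instance : LieRing (AnalyticVF U) where
  add_lie X Y Z := ext_on fun z hz => by
    rw [lie_apply _ _ hz, coe_add, coe_add, Pi.add_apply, lie_apply _ _ hz, lie_apply _ _ hz]
    exact VectorField.lieBracket_add_left (X.analyticAt hz).differentiableAt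
      (Y.analyticAt hz).differentiableAt
  lie_add X Y Z := ext_on fun z hz => by
    rw [lie_apply _ _ hz, coe_add, coe_add, Pi.add_apply, lie_apply _ _ hz, lie_apply _ _ hz]
    exact VectorField.lieBracket_add_right (Y.analyticAt hz).differentiableAt
      (Z.analyticAt hz).differentiableAt
  lie_self X := ext_on fun z hz => by
    rw [lie_apply _ _ hz, VectorField.lieBracket_self, coe_zero]
  leibniz_lie X Y Z := ext_on fun z hz => by
    rw [lie_apply _ _ hz, coe_add, Pi.add_apply, lie_apply _ _ hz, lie_apply _ _ hz,
      (Filter.EventuallyEq.refl _ _).lieBracket_vectorField_eq (lie_eventuallyEq Y Z hz),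
      (lie_eventuallyEq X Y hz).lieBracket_vectorField_eq (Filter.EventuallyEq.refl _ _),
      (Filter.EventuallyEq.refl _ _).lieBracket_vectorField_eq (lie_eventuallyEq X Z hz)]
    exact VectorField.leibniz_identity_lieBracket (n := 2) (by simp)
      (X.analyticAt hz).contDiffAt (Y.analyticAt hz).contDiffAt (Z.analyticAt hz).contDiffAt

noncomputable instance : LieAlgebra ℝ (AnalyticVF U) where
  lie_smul c X Y := ext_on fun z hz => by
    rw [lie_apply _ _ hz, coe_smul, coe_smul, Pi.smul_apply, lie_apply _ _ hz]
    exact VectorField.lieBracket_const_smul_right (Y.analyticAt hz).differentiableAt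

end AnalyticVF

/-- The underlying set of vector fields of a Lie algebra of analytic vector fields on `U`. -/
noncomputable def fieldsOf {U : TopologicalSpace.Opens Plane} (g : LieSubalgebra ℝ (AnalyticVF U)) :
    Set (Plane → Plane) :=
  {X | ∃ Y ∈ g, X = ⇑Y}

/-- The commutator (derived) ideal `g' = [g, g]`. -/
noncomputable abbrev commutatorIdeal {U : TopologicalSpace.Opens Plane} (g : LieSubalgebra ℝ (AnalyticVF U)) :
    LieIdeal ℝ g :=
  ⁅(⊤ : LieIdeal ℝ g), (⊤ : LieIdeal ℝ g)⁆

/-- The vector fields on `U` that belong to the commutator ideal. -/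
noncomputable def commutatorFieldsOf {U : TopologicalSpace.Opens Plane}
    (g : LieSubalgebra ℝ (AnalyticVF U)) : Set (Plane → Plane) :=
  {X | ∃ Y : g, Y ∈ commutatorIdeal g ∧ X = ⇑(Y : AnalyticVF U)}

/-! ### Orbits, their dimension, invariant sets -/

section Orbits

variable {E : Type*} [NormedAddCommGroup E] [NormedSpace ℝ E]

/-- `q` is reached from `p` along an integral curve, inside `M`, of one of the vector fields
of the family `𝔛`. -/
def FlowsTo (𝔛 : Set (E → E)) (M : Set E) (p q : E) : Prop :=
  ∃ X ∈ 𝔛, ∃ T : ℝ, 0 ≤ T ∧ ∃ γ : ℝ → E, γ 0 = p ∧ γ T = q ∧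
    ∀ t ∈ Icc 0 T, γ t ∈ M ∧ HasDerivWithinAt γ (X (γ t)) (Icc 0 T) t

/-- The orbit of `p` under a family of vector fields on `M` : the points that are reached from
`p` along finitely many successive integral curves (for a vector space of vector fields this
relation is symmetric, since the time-reversed curves are integral curves of `-X`). -/
def orbit (𝔛 : Set (E → E)) (M : Set E) (p : E) : Set E :=
  {q | Relation.ReflTransGen (FlowsTo 𝔛 M) p q}

/-- The dimension, at its point `p`, of the orbit of `p` : the dimension of its tangent space, the
space spanned by the velocities at `p` of the `C¹` curves through `p` that lie in the orbit. -/
noncomputable def orbitDim (𝔛 : Set (E → E)) (M : Set E) (p : E) : ℕ :=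
  Module.finrank ℝ (Submodule.span ℝ {v : E | ∃ ε : ℝ, 0 < ε ∧ ∃ γ : ℝ → E,
    γ 0 = p ∧ ContDiffOn ℝ 1 γ (Ioo (-ε) ε) ∧ (∀ t ∈ Ioo (-ε) ε, γ t ∈ orbit 𝔛 M p) ∧
    HasDerivAt γ v 0})

/-- The generic orbits are `r`-dimensional, and `W` is the set of generic points: `W` is a
nonempty open subset of `M`, the orbits of points of `W` have dimension `r`, and the orbits of the
other points of `M` have lower dimension. -/
def GenericOrbits (𝔛 : Set (E → E)) (M W : Set E) (r : ℕ) : Prop :=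
  IsOpen W ∧ W.Nonempty ∧ W ⊆ M ∧
    (∀ p ∈ W, orbitDim 𝔛 M p = r) ∧ ∀ p ∈ M \ W, orbitDim 𝔛 M p < r

/-- The rank of a family of vector fields on `M`, the dimension of its generic orbits, is `r`. -/
def HasRank (𝔛 : Set (E → E)) (M : Set E) (r : ℕ) : Prop :=
  ∃ W : Set E, GenericOrbits 𝔛 M W r

/-- The subset `H` of `M` is invariant: it is a union of orbits. -/
def IsInvariantSet (𝔛 : Set (E → E)) (M H : Set E) : Prop :=
  H ⊆ M ∧ ∀ p ∈ H, orbit 𝔛 M p ⊆ H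

end Orbits

/-! ### Jets and prolongation -/

/-- The space of second-order jets `(x, y, y', y'')`. -/
abbrev Jet2 : Type := ℝ × ℝ × ℝ × ℝ

/-- The space of third-order jets `(x, y, y', y'', y''')`. -/
abbrev Jet3 : Type := ℝ × ℝ × ℝ × ℝ × ℝ

/-- `(x, y, y', y'', y''') ↦ (x, y)`. -/
def Jet3.base : Jet3 → Plane := fun (x, y, _, _, _) => (x, y)

/-- `(x, y, y', y'', y''') ↦ (x, y, y', y'')`. -/
def Jet3.toJet2 : Jet3 → Jet2 := fun (x, y, y₁, y₂, _) => (x, y, y₁, y₂)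

/-- `(x, y, y', y'') ↦ (x, y)`. -/
def Jet2.base : Jet2 → Plane := fun (x, y, _, _) => (x, y)

/-- The total derivative
`D F = ∂F/∂x + y' ∂F/∂y + y'' ∂F/∂y' + y''' ∂F/∂y''`
of a function `F` of `(x, y, y', y'')`, viewed as a function on the third-order jets. -/
noncomputable def totalDeriv (F : Jet3 → ℝ) : Jet3 → ℝ :=
  fun (x, y, y₁, y₂, y₃) => fderiv ℝ F (x, y, y₁, y₂, y₃) (1, y₁, y₂, y₃, 0)

/-- The coefficient `η₁ = D η - y' D ξ` of `∂/∂y'` in the prolongation of `ξ ∂/∂x + η ∂/∂y`. -/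
noncomputable def prolongCoeff1 (X : Plane → Plane) : Jet3 → ℝ := fun j =>
  totalDeriv (fun i => (X i.base).2) j - j.2.2.1 * totalDeriv (fun i => (X i.base).1) j

/-- The coefficient `η₂ = D η₁ - y'' D ξ` of `∂/∂y''`. -/
noncomputable def prolongCoeff2 (X : Plane → Plane) : Jet3 → ℝ := fun j =>
  totalDeriv (prolongCoeff1 X) j - j.2.2.2.1 * totalDeriv (fun i => (X i.base).1) j

/-- The coefficient `η₃ = D η₂ - y''' D ξ` of `∂/∂y'''`. -/
noncomputable def prolongCoeff3 (X : Plane → Plane) : Jet3 → ℝ := fun j =>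
  totalDeriv (prolongCoeff2 X) j - j.2.2.2.2 * totalDeriv (fun i => (X i.base).1) j

/-- The third prolongation
`ξ ∂/∂x + η ∂/∂y + η₁ ∂/∂y' + η₂ ∂/∂y'' + η₃ ∂/∂y'''` of `X = ξ ∂/∂x + η ∂/∂y`. -/
noncomputable def prolong3 (X : Plane → Plane) : Jet3 → Jet3 := fun j =>
  ((X j.base).1, (X j.base).2, prolongCoeff1 X j, prolongCoeff2 X j, prolongCoeff3 X j)

/-! ### Coordinate changes and the canonical form -/

/-- The vector field `X` written in the coordinates `Φ` : a vector field on the target of `Φ`,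
extended by `0` outside the target. -/
noncomputable def inCoords (Φ : OpenPartialHomeomorph Plane Plane) (X : Plane → Plane) :
    Plane → Plane :=
  Φ.target.indicator fun z => fderiv ℝ Φ (Φ.symm z) (X (Φ.symm z))

/-- The vector field `h(x, y) ∂/∂y` on `V` (extended by `0` outside `V`). -/
noncomputable def vertical (V : Set Plane) (h : ℝ → ℝ → ℝ) : Plane → Plane :=
  V.indicator fun (x, y) => (0, h x y)

/-- `Φ` is an analytic coordinate system on a nonempty open subset of `U`, and `φ` an analytic
function of the coordinate `x` with `φ''` nowhere zero, such that in these coordinates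
`g' = ⟨∂/∂y, x ∂/∂y, φ(x) ∂/∂y⟩` and `g = ⟨y ∂/∂y, ∂/∂y, x ∂/∂y, φ(x) ∂/∂y⟩`. -/
structure IsCanonicalChart {U : TopologicalSpace.Opens Plane}
    (g : LieSubalgebra ℝ (AnalyticVF U)) (Φ : OpenPartialHomeomorph Plane Plane) (φ : ℝ → ℝ) :
    Prop where
  source_nonempty : Φ.source.Nonempty
  source_subset : Φ.source ⊆ U
  analytic : AnalyticOnNhd ℝ Φ Φ.source
  analytic_symm : AnalyticOnNhd ℝ Φ.symm Φ.target
  phi_analytic : AnalyticOnNhd ℝ φ (Prod.fst '' Φ.target)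
  phi_second_ne_zero : ∀ x ∈ Prod.fst '' Φ.target, iteratedDeriv 2 φ x ≠ 0
  commutator_eq : inCoords Φ '' commutatorFieldsOf g =
    Submodule.span ℝ {vertical Φ.target (fun _ _ => 1), vertical Φ.target (fun x _ => x),
      vertical Φ.target (fun x _ => φ x)}
  algebra_eq : inCoords Φ '' fieldsOf g =
    Submodule.span ℝ {vertical Φ.target (fun _ y => y), vertical Φ.target (fun _ _ => 1),
      vertical Φ.target (fun x _ => x), vertical Φ.target (fun x _ => φ x)}

/-- The third prolongation of `g`, written in the coordinates `Φ`. -/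
def prolongedFields {U : TopologicalSpace.Opens Plane} (g : LieSubalgebra ℝ (AnalyticVF U))
    (Φ : OpenPartialHomeomorph Plane Plane) : Set (Jet3 → Jet3) :=
  (fun X => prolong3 (inCoords Φ X)) '' fieldsOf g

/-- The hypersurface `y''' = f(x, y, y', y'')` over the set `D` of second-order jets. -/
def hypersurface (D : Set Jet2) (f : Jet2 → ℝ) : Set Jet3 :=
  {j | j.toJet2 ∈ D ∧ j.2.2.2.2 = f j.toJet2}

/-!
Rank one says that any two fields of `g` are proportional at every point: where two of them are
independent, the integral curves through the point already give the orbit dimension two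
(`det_eq_zero_of_hasRank_one`). Since `g'` is abelian, a dimension count shows that it has dimension
`3` and that `g` is spanned by `g'` and `q`.

Given a basis `v₀, v₁, v₂` of `g'`, away from the zeros of `v₀` every field of `g` is a multiple of
`v₀`. From `[v₀, f v₀] = v₀(f) v₀` the ratios `a = v₁ / v₀` and `b = v₂ / v₀` are first integrals of
`v₀`. If `q = ρ v₀` then `ad q` multiplies the fields of `g'` by the function `-v₀(ρ)`; as
`(ad q - c)ᵏ` kills `g'`, this function is the constant `c`. Hence `y = -ρ / c` satisfies
`v₀(y) = 1`, and `(x, y) = (a, y)` are coordinates as soon as `da ≠ 0`: no rectification of `v₀` is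
needed, only the analytic inverse function theorem (`exists_straightening`). In them `v₀ = ∂/∂y`,
`v₁ = x ∂/∂y`, `-q / c = y ∂/∂y`, and `b` is a function `φ` of `x`. If `a` were constant, or `φ`
affine, on an open set, the identity theorem would make the basis linearly dependent; so the domains
of these charts are dense (`exists_canonicalChart`).

In a canonical chart the prolonged fields are
`(0, αy + s, αy' + s', αy'' + s'', αy''' + s''')` with `s = β + γx + δφ(x)`
(`prolong3_vertical_combination`). Along their flows `x` is constant and
`I = y'' φ'''(x) - φ''(x) y'''` satisfies the linear equation `dI/dt = α I`. Where `I ≠ 0` the fields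
fill the four-dimensional space of vertical directions; where `I = 0` the orbit stays in the
three-dimensional space cut out by `x` and `I`. A hypersurface given by a function of second-order
jets is invariant if `I = 0` on it; otherwise the fields that fix a second-order jet move the point
over it along the fibre, off the hypersurface (`exists_mem_orbit_toJet2_eq`).
-/

/-! ### Tangent spaces of orbits -/

section Orbits

variable {E : Type*} [NormedAddCommGroup E] [NormedSpace ℝ E]

/-- The tangent space at `p` of the orbit of `p`, whose dimension is `orbitDim`. -/
def orbitTangent (𝔛 : Set (E → E)) (M : Set E) (p : E) : Submodule ℝ E :=
  Submodule.span ℝ {v : E | ∃ ε : ℝ, 0 < ε ∧ ∃ γ : ℝ → E,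
    γ 0 = p ∧ ContDiffOn ℝ 1 γ (Ioo (-ε) ε) ∧ (∀ t ∈ Ioo (-ε) ε, γ t ∈ orbit 𝔛 M p) ∧
    HasDerivAt γ v 0}

theorem orbitDim_eq_finrank (𝔛 : Set (E → E)) (M : Set E) (p : E) :
    orbitDim 𝔛 M p = Module.finrank ℝ (orbitTangent 𝔛 M p) := rfl

/-- Values of the fields of the family are tangent to the orbits. The curve that proves it is an
integral curve in both directions of time, while `orbit` uses forward time only: hence the
field `Y`, equal to `-X` on `M`. -/
theorem apply_mem_orbitTangent [CompleteSpace E] {𝔛 : Set (E → E)} {M : Set E} {p : E}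
    {X Y : E → E} (hX : X ∈ 𝔛) (hY : Y ∈ 𝔛) (hXY : ∀ z ∈ M, Y z = -X z) (hM : IsOpen M)
    (hp : p ∈ M) (hXc : ∀ z ∈ M, ContDiffAt ℝ 1 X z) : X p ∈ orbitTangent 𝔛 M p := by
  obtain ⟨γ, hγ0, ε, hε, hγ⟩ :=
    (hXc p hp).exists_forall_mem_closedBall_exists_eq_forall_mem_Ioo_hasDerivAt₀ 0
  simp only [zero_sub, zero_add] at hγ
  have h0 : HasDerivAt γ (X p) 0 := hγ0 ▸ hγ 0 ⟨by linarith, hε⟩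
  have hev : ∀ᶠ t in nhds (0 : ℝ), γ t ∈ M :=
    h0.continuousAt.eventually (hγ0.symm ▸ hM.mem_nhds hp)
  obtain ⟨δ, hδ, hδM⟩ := Metric.eventually_nhds_iff.1 hev
  set r := min ε δ with hr
  have hr0 : 0 < r := lt_min hε hδ
  have hrγ : ∀ t ∈ Ioo (-r) r, HasDerivAt γ (X (γ t)) t := fun t ht =>
    hγ t ⟨by linarith [ht.1, min_le_left ε δ], by linarith [ht.2, min_le_left ε δ]⟩
  have hrM : ∀ t ∈ Ioo (-r) r, γ t ∈ M := fun t ht => hδM <| by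
    rw [Real.dist_eq, sub_zero, abs_lt]
    exact ⟨by linarith [ht.1, min_le_right ε δ], by linarith [ht.2, min_le_right ε δ]⟩
  refine Submodule.subset_span ⟨r, hr0, γ, hγ0, ?_, ?_, h0⟩
  · rw [contDiffOn_one_iff_derivWithin isOpen_Ioo.uniqueDiffOn]
    refine ⟨fun t ht => (hrγ t ht).differentiableAt.differentiableWithinAt, ?_⟩
    refine ContinuousOn.congr (f := fun t => X (γ t)) ?_ fun t ht => by
      rw [derivWithin_of_isOpen isOpen_Ioo ht, (hrγ t ht).deriv]
    exact fun t ht => ((hXc _ (hrM t ht)).continuousAt.comp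
      (hrγ t ht).continuousAt).continuousWithinAt
  · intro t ht
    refine Relation.ReflTransGen.single ?_
    rcases le_total 0 t with h | h
    · refine ⟨X, hX, t, h, γ, hγ0, rfl, fun s hs => ?_⟩
      have hs' : s ∈ Ioo (-r) r := ⟨by linarith [hs.1], by linarith [hs.2, ht.2]⟩
      exact ⟨hrM s hs', (hrγ s hs').hasDerivWithinAt⟩
    · refine ⟨Y, hY, -t, by linarith, fun s => γ (-s), by simpa using hγ0, by simp,
        fun s hs => ?_⟩
      have hs' : -s ∈ Ioo (-r) r := ⟨by linarith [hs.2, ht.1], by linarith [hs.1]⟩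
      refine ⟨hrM _ hs', ?_⟩
      rw [hXY _ (hrM _ hs')]
      simpa using! ((hrγ _ hs').scomp s (hasDerivAt_neg s)).hasDerivWithinAt

/-- A linear function that is constant on the orbit vanishes on its tangent space. -/
theorem orbitTangent_le_ker {F : Type*} [NormedAddCommGroup F] [NormedSpace ℝ F]
    {𝔛 : Set (E → E)} {M : Set E} {p : E} (L : E →L[ℝ] F)
    (hL : ∀ q ∈ orbit 𝔛 M p, L q = L p) : orbitTangent 𝔛 M p ≤ LinearMap.ker L.toLinearMap := by
  refine Submodule.span_le.2 ?_
  rintro v ⟨ε, hε, γ, -, -, horb, hγ⟩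
  have h1 : HasDerivAt (fun t => L (γ t)) (L v) 0 := L.hasFDerivAt.comp_hasDerivAt 0 hγ
  have h2 : HasDerivAt (fun t => L (γ t)) 0 0 := by
    refine (hasDerivAt_const (0 : ℝ) (L p)).congr_of_eventuallyEq ?_
    filter_upwards [Ioo_mem_nhds (neg_lt_zero.2 hε) hε] with t ht using hL _ (horb t ht)
  exact h1.unique h2

/-- A property that every integral curve transports from its start to its end holds on an orbit as
soon as it holds at one point. -/
theorem orbit_induction {𝔛 : Set (E → E)} {M : Set E} {p : E} {P : E → Prop} (hp : P p)
    (hP : ∀ X ∈ 𝔛, ∀ T : ℝ, 0 ≤ T → ∀ γ : ℝ → E, P (γ 0) →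
      (∀ t ∈ Icc 0 T, γ t ∈ M ∧ HasDerivWithinAt γ (X (γ t)) (Icc 0 T) t) → P (γ T))
    {q : E} (hq : q ∈ orbit 𝔛 M p) : P q := by
  induction hq with
  | refl => exact hp
  | tail _ h ih =>
    obtain ⟨X, hX, T, hT, γ, h0, rfl, hγ⟩ := h
    exact hP X hX T hT γ (h0 ▸ ih) hγ

theorem orbit_subset {𝔛 : Set (E → E)} {M : Set E} {p : E} (hp : p ∈ M) : orbit 𝔛 M p ⊆ M :=
  fun _ hq => orbit_induction hp (fun _ _ T hT _ _ h => (h T ⟨hT, le_rfl⟩).1) hq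

end Orbits

/-- A solution of `u' = α u` that starts at `0` stays `0`. -/
theorem eq_zero_of_hasDerivWithinAt_mul {u : ℝ → ℝ} {α T : ℝ} (hT : 0 ≤ T)
    (hu : ∀ t ∈ Icc 0 T, HasDerivWithinAt u (α * u t) (Icc 0 T) t) (h0 : u 0 = 0) : u T = 0 := by
  have hd : ∀ t ∈ Icc 0 T,
      HasDerivWithinAt (fun t => u t * Real.exp (-α * t)) 0 (Icc 0 T) t := fun t ht => by
    have he : HasDerivAt (fun t : ℝ => Real.exp (-α * t)) (Real.exp (-α * t) * (-α)) t := by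
      simpa using ((hasDerivAt_id t).const_mul (-α)).exp
    convert! (hu t ht).mul he.hasDerivWithinAt using 1
    ring
  have hc := constant_of_derivWithin_zero (fun t ht => (hd t ht).differentiableWithinAt)
    (fun t ht => by
      rcases eq_or_lt_of_le hT with rfl | hT'
      · exact absurd ht.2 (not_lt.2 ht.1)
      exact (hd t ⟨ht.1, ht.2.le⟩).derivWithin (uniqueDiffOn_Icc hT' t ⟨ht.1, ht.2.le⟩))
    T ⟨hT, le_rfl⟩
  simpa [h0, Real.exp_ne_zero] using hc

/-! ### Prolongation of vertical fields -/

/-- The total derivative of a function that near `j` is `α L + s(x)` with `L` linear. -/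
theorem totalDeriv_eq {F : Jet3 → ℝ} {s : ℝ → ℝ} {s' : ℝ} (α : ℝ) (L : Jet3 →L[ℝ] ℝ) {j : Jet3}
    (hs : HasDerivAt s s' j.1) (hF : F =ᶠ[nhds j] fun i => α * L i + s i.1) :
    totalDeriv F j = α * L (1, j.2.2.1, j.2.2.2.1, j.2.2.2.2, 0) + s' := by
  have h1 : HasFDerivAt (fun i : Jet3 => α * L i + s i.1)
      (α • L + s' • ContinuousLinearMap.fst ℝ ℝ _) j :=
    (L.hasFDerivAt.const_mul α).add
      (hs.comp_hasFDerivAt j (ContinuousLinearMap.fst ℝ ℝ (ℝ × ℝ × ℝ × ℝ)).hasFDerivAt)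
  change fderiv ℝ F j _ = _
  rw [hF.fderiv_eq, h1.fderiv]
  simp

theorem continuous_base : Continuous Jet3.base :=
  continuous_fst.prodMk (continuous_fst.comp continuous_snd)

theorem eventually_base_mem {V : Set Plane} (hV : IsOpen V) {j : Jet3} (hj : j.base ∈ V) :
    ∀ᶠ i in nhds j, Jet3.base i ∈ V :=
  continuous_base.continuousAt.eventually (hV.mem_nhds hj)

section Prolongation

variable {V : Set Plane} {X : Plane → Plane} {α : ℝ} {s₀ s₁ s₂ s₃ : ℝ → ℝ}

/-- The third prolongation of `(α y + s(x)) ∂/∂y`. -/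
theorem prolong3_eq (hV : IsOpen V) (hX : ∀ z ∈ V, X z = (0, α * z.2 + s₀ z.1))
    (h₀ : ∀ x ∈ Prod.fst '' V, HasDerivAt s₀ (s₁ x) x)
    (h₁ : ∀ x ∈ Prod.fst '' V, HasDerivAt s₁ (s₂ x) x)
    (h₂ : ∀ x ∈ Prod.fst '' V, HasDerivAt s₂ (s₃ x) x) {j : Jet3} (hj : j.base ∈ V) :
    prolong3 X j = (0, α * j.2.1 + s₀ j.1, α * j.2.2.1 + s₁ j.1, α * j.2.2.2.1 + s₂ j.1,
      α * j.2.2.2.2 + s₃ j.1) := by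
  have hfst : ∀ i : Jet3, i.base ∈ V → i.1 ∈ Prod.fst '' V := fun i hi => ⟨i.base, hi, rfl⟩
  have hξ : ∀ i : Jet3, i.base ∈ V → totalDeriv (fun i => (X i.base).1) i = 0 := fun i hi => by
    rw [totalDeriv_eq 0 0 (hasDerivAt_const i.1 0)]
    · simp
    · filter_upwards [eventually_base_mem hV hi] with k hk
      simp [hX _ hk]
  have hη₁ : ∀ i : Jet3, i.base ∈ V → prolongCoeff1 X i = α * i.2.2.1 + s₁ i.1 := fun i hi => by
    rw [prolongCoeff1, hξ i hi, totalDeriv_eq α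
      ((ContinuousLinearMap.fst ℝ ℝ _).comp (ContinuousLinearMap.snd ℝ ℝ _)) (h₀ _ (hfst i hi))]
    · simp
    · filter_upwards [eventually_base_mem hV hi] with k hk
      rw [hX _ hk]
      rfl
  have hη₂ : ∀ i : Jet3, i.base ∈ V → prolongCoeff2 X i = α * i.2.2.2.1 + s₂ i.1 :=
    fun i hi => by
    rw [prolongCoeff2, hξ i hi, totalDeriv_eq α
      ((ContinuousLinearMap.fst ℝ ℝ _).comp ((ContinuousLinearMap.snd ℝ ℝ _).comp
        (ContinuousLinearMap.snd ℝ ℝ _))) (h₁ _ (hfst i hi))]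
    · simp
    · filter_upwards [eventually_base_mem hV hi] with k hk
      rw [hη₁ _ hk]
      rfl
  have hη₃ : prolongCoeff3 X j = α * j.2.2.2.2 + s₃ j.1 := by
    rw [prolongCoeff3, hξ j hj, totalDeriv_eq α
      ((ContinuousLinearMap.fst ℝ ℝ _).comp ((ContinuousLinearMap.snd ℝ ℝ _).comp
        ((ContinuousLinearMap.snd ℝ ℝ _).comp (ContinuousLinearMap.snd ℝ ℝ _))))
        (h₂ _ (hfst j hj))]
    · simp
    · filter_upwards [eventually_base_mem hV hj] with k hk
      rw [hη₂ _ hk]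
      rfl
  rw [prolong3, hX _ hj, hη₁ j hj, hη₂ j hj, hη₃]
  rfl

end Prolongation

/-- The third prolongation of the field `(α y + β + γ x + δ φ(x)) ∂/∂y`, in closed form. -/
noncomputable def prolongedVertical (φ : ℝ → ℝ) (α β γ δ : ℝ) : Jet3 → Jet3 := fun j =>
  (0, α * j.2.1 + (β + γ * j.1 + δ * φ j.1), α * j.2.2.1 + (γ + δ * iteratedDeriv 1 φ j.1),
    α * j.2.2.2.1 + δ * iteratedDeriv 2 φ j.1, α * j.2.2.2.2 + δ * iteratedDeriv 3 φ j.1)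

/-- A jet-space family of fields that, over `V`, consists of the prolongations of the fields
`(α y + β + γ x + δ φ(x)) ∂/∂y`. -/
structure IsProlongedCanonical (𝔛 : Set (Jet3 → Jet3)) (V : Set Plane) (φ : ℝ → ℝ) : Prop where
  isOpen : IsOpen V
  analytic : AnalyticOnNhd ℝ φ (Prod.fst '' V)
  second_ne_zero : ∀ x ∈ Prod.fst '' V, iteratedDeriv 2 φ x ≠ 0
  exists_coeff : ∀ Z ∈ 𝔛, ∃ α β γ δ : ℝ, ∀ j : Jet3, j.base ∈ V →
    Z j = prolongedVertical φ α β γ δ j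
  exists_field : ∀ α β γ δ : ℝ, ∃ Z ∈ 𝔛, ∀ j : Jet3, j.base ∈ V →
    Z j = prolongedVertical φ α β γ δ j

section Analytic

variable {V : Set Plane} {φ : ℝ → ℝ}

theorem analyticAt_iteratedDeriv (hφ : AnalyticOnNhd ℝ φ (Prod.fst '' V)) (n : ℕ) {x : ℝ}
    (hx : x ∈ Prod.fst '' V) : AnalyticAt ℝ (iteratedDeriv n φ) x := by
  rw [iteratedDeriv_eq_iterate]
  exact hφ.iterated_deriv n x hx

theorem hasDerivAt_iteratedDeriv (hφ : AnalyticOnNhd ℝ φ (Prod.fst '' V)) (n : ℕ) {x : ℝ}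
    (hx : x ∈ Prod.fst '' V) :
    HasDerivAt (iteratedDeriv n φ) (iteratedDeriv (n + 1) φ x) x := by
  rw [iteratedDeriv_succ]
  exact (analyticAt_iteratedDeriv hφ n hx).differentiableAt.hasDerivAt

theorem prolong3_vertical_combination (hV : IsOpen V) (hφ : AnalyticOnNhd ℝ φ (Prod.fst '' V))
    {X : Plane → Plane} {α β γ δ : ℝ}
    (hX : ∀ z ∈ V, X z = (0, α * z.2 + (β + γ * z.1 + δ * φ z.1))) {j : Jet3} (hj : j.base ∈ V) :
    prolong3 X j = prolongedVertical φ α β γ δ j := by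
  refine prolong3_eq (s₀ := fun x => β + γ * x + δ * φ x)
    (s₁ := fun x => γ + δ * iteratedDeriv 1 φ x) (s₂ := fun x => δ * iteratedDeriv 2 φ x)
    (s₃ := fun x => δ * iteratedDeriv 3 φ x) hV hX (fun x hx => ?_) (fun x hx => ?_)
    (fun x hx => (hasDerivAt_iteratedDeriv hφ 2 hx).const_mul δ) hj
  · have h := hasDerivAt_iteratedDeriv hφ 0 hx
    rw [iteratedDeriv_zero] at h
    simpa using! (((hasDerivAt_id x).const_mul γ).const_add β).add (h.const_mul δ)
  · exact ((hasDerivAt_iteratedDeriv hφ 1 hx).const_mul δ).const_add γ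

theorem contDiffAt_prolongedVertical (hφ : AnalyticOnNhd ℝ φ (Prod.fst '' V)) (α β γ δ : ℝ)
    {j : Jet3} (hj : j.base ∈ V) : ContDiffAt ℝ 1 (prolongedVertical φ α β γ δ) j := by
  have hit : ∀ n, ContDiffAt ℝ 1 (fun i : Jet3 => iteratedDeriv n φ i.1) j := fun n =>
    (analyticAt_iteratedDeriv hφ n (x := j.1) ⟨j.base, hj, rfl⟩).contDiffAt.comp j contDiffAt_fst
  have h0 := hit 0
  rw [iteratedDeriv_zero] at h0
  have hx : ContDiffAt ℝ 1 (fun i : Jet3 => i.1) j := by fun_prop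
  have hy : ∀ L : Jet3 →L[ℝ] ℝ, ContDiffAt ℝ 1 (fun i : Jet3 => α * L i) j := fun L =>
    contDiffAt_const.mul L.contDiff.contDiffAt
  have hδ : ∀ {F : Jet3 → ℝ}, ContDiffAt ℝ 1 F j → ContDiffAt ℝ 1 (fun i => δ * F i) j :=
    fun hF => contDiffAt_const.mul hF
  let L := ContinuousLinearMap.snd ℝ ℝ (ℝ × ℝ × ℝ × ℝ)
  let L₁ := (ContinuousLinearMap.snd ℝ ℝ (ℝ × ℝ × ℝ)).comp L
  let L₂ := (ContinuousLinearMap.snd ℝ ℝ (ℝ × ℝ)).comp L₁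
  exact contDiffAt_const.prodMk
    (((hy ((ContinuousLinearMap.fst ℝ _ _).comp L)).add
      ((contDiffAt_const.add (contDiffAt_const.mul hx)).add (hδ h0))).prodMk
    (((hy ((ContinuousLinearMap.fst ℝ _ _).comp L₁)).add
      (contDiffAt_const.add (hδ (hit 1)))).prodMk
    (((hy ((ContinuousLinearMap.fst ℝ _ _).comp L₂)).add (hδ (hit 2))).prodMk
    ((hy ((ContinuousLinearMap.snd ℝ _ _).comp L₂)).add (hδ (hit 3))))))

end Analytic

/-- In a canonical chart the prolonged algebra is the prolongation of the canonical fields. -/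
theorem IsCanonicalChart.isProlongedCanonical {U : TopologicalSpace.Opens Plane}
    {g : LieSubalgebra ℝ (AnalyticVF U)} {Φ : OpenPartialHomeomorph Plane Plane} {φ : ℝ → ℝ}
    (h : IsCanonicalChart g Φ φ) : IsProlongedCanonical (prolongedFields g Φ) Φ.target φ := by
  have key : ∀ α β γ δ : ℝ, ∀ z ∈ Φ.target,
      (α • vertical Φ.target (fun _ y => y) + (β • vertical Φ.target (fun _ _ => 1)
        + (γ • vertical Φ.target (fun x _ => x) + δ • vertical Φ.target (fun x _ => φ x)))) z
        = (0, α * z.2 + (β + γ * z.1 + δ * φ z.1)) := fun α β γ δ z hz => by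
    simp only [vertical, Pi.add_apply, Pi.smul_apply, indicator_of_mem hz]
    ext <;> simp
    ring
  have hset : prolongedFields g Φ = prolong3 '' (inCoords Φ '' fieldsOf g) := by
    rw [image_image]
    rfl
  refine ⟨Φ.open_target, h.phi_analytic, h.phi_second_ne_zero, ?_, ?_⟩
  · rw [hset, h.algebra_eq]
    rintro _ ⟨X, hX, rfl⟩
    obtain ⟨α, X₁, hX₁, rfl⟩ := Submodule.mem_span_insert.1 hX
    obtain ⟨β, X₂, hX₂, rfl⟩ := Submodule.mem_span_insert.1 hX₁
    obtain ⟨γ, δ, rfl⟩ := Submodule.mem_span_pair.1 hX₂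
    exact ⟨α, β, γ, δ, fun j hj =>
      prolong3_vertical_combination Φ.open_target h.phi_analytic (key α β γ δ) hj⟩
  · intro α β γ δ
    rw [hset, h.algebra_eq]
    refine ⟨_, ⟨_, Submodule.mem_span_insert.2 ⟨α, _, Submodule.mem_span_insert.2
      ⟨β, _, Submodule.mem_span_pair.2 ⟨γ, δ, rfl⟩, rfl⟩, rfl⟩, rfl⟩, fun j hj =>
      prolong3_vertical_combination Φ.open_target h.phi_analytic (key α β γ δ) hj⟩

/-! ### Orbits and invariant hypersurfaces of the prolonged algebra -/

/-- The function `y'' φ'''(x) - φ''(x) y'''` on jets, a relative invariant of the prolonged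
algebra. -/
noncomputable def relativeInvariant (φ : ℝ → ℝ) (j : Jet3) : ℝ :=
  j.2.2.2.1 * iteratedDeriv 3 φ j.1 - iteratedDeriv 2 φ j.1 * j.2.2.2.2

/-- The coordinate `x` of a jet, as a linear map. -/
noncomputable def xComponent : Jet3 →L[ℝ] ℝ := ContinuousLinearMap.fst ℝ ℝ _

/-- The coordinate `x` of a jet together with the relative invariant, whose coefficients are frozen
at a fixed value of `x` so that it becomes linear. -/
noncomputable def frozenInvariant (φ : ℝ → ℝ) (x : ℝ) : Jet3 →L[ℝ] ℝ × ℝ :=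
  xComponent.prod (((ContinuousLinearMap.fst ℝ ℝ _).smulRight (iteratedDeriv 3 φ x)
    - (ContinuousLinearMap.snd ℝ ℝ ℝ).smulRight (iteratedDeriv 2 φ x)).comp
    ((ContinuousLinearMap.snd ℝ ℝ _).comp ((ContinuousLinearMap.snd ℝ ℝ _).comp
      (ContinuousLinearMap.snd ℝ ℝ _))))

theorem frozenInvariant_apply (φ : ℝ → ℝ) (x : ℝ) (j : Jet3) : frozenInvariant φ x j =
    (j.1, j.2.2.2.1 * iteratedDeriv 3 φ x - iteratedDeriv 2 φ x * j.2.2.2.2) := by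
  simp [frozenInvariant, xComponent, mul_comm]

theorem finrank_ker_xComponent :
    Module.finrank ℝ (LinearMap.ker xComponent.toLinearMap) = 4 := by
  have h := xComponent.toLinearMap.finrank_range_add_finrank_ker
  rw [LinearMap.range_eq_top.2 Prod.fst_surjective] at h
  simp at h
  omega

theorem finrank_ker_frozenInvariant {φ : ℝ → ℝ} {x : ℝ} (h2 : iteratedDeriv 2 φ x ≠ 0) :
    Module.finrank ℝ (LinearMap.ker (frozenInvariant φ x).toLinearMap) = 3 := by
  have h := (frozenInvariant φ x).toLinearMap.finrank_range_add_finrank_ker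
  rw [LinearMap.range_eq_top.2 fun w => ⟨(w.1, 0, 0, 0, -w.2 / iteratedDeriv 2 φ x), by
    simp [frozenInvariant_apply]; ext <;> simp; field_simp⟩] at h
  simp at h
  omega

namespace IsProlongedCanonical

variable {𝔛 : Set (Jet3 → Jet3)} {V : Set Plane} {φ : ℝ → ℝ} {M : Set Jet3}

/-- `x` is constant on the orbits of the prolonged algebra. -/
theorem fst_eq_of_mem_orbit (h : IsProlongedCanonical 𝔛 V φ) (hM : ∀ j ∈ M, j.base ∈ V)
    {p q : Jet3} (hq : q ∈ orbit 𝔛 M p) : q.1 = p.1 := by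
  refine orbit_induction (P := fun q => q.1 = p.1) rfl (fun X hX T hT γ h0 hγ => ?_) hq
  obtain ⟨α, β, c, δ, hXe⟩ := h.exists_coeff X hX
  have := eq_zero_of_hasDerivWithinAt_mul (u := fun t => (γ t).1 - p.1) (α := 0) hT
    (fun t ht => by
      have h1 := xComponent.hasFDerivAt.comp_hasDerivWithinAt t (hγ t ht).2
      rw [hXe _ (hM _ (hγ t ht).1)] at h1
      simpa [xComponent, prolongedVertical] using! h1.sub_const p.1) (by simp [h0])
  linarith

/-- The zero set of the relative invariant is invariant. -/
theorem relativeInvariant_eq_zero_of_mem_orbit (h : IsProlongedCanonical 𝔛 V φ)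
    (hM : ∀ j ∈ M, j.base ∈ V) {p q : Jet3} (hp : relativeInvariant φ p = 0)
    (hq : q ∈ orbit 𝔛 M p) : relativeInvariant φ q = 0 := by
  -- since `x` is constant along the flow, the invariant may be frozen at the initial `x`; along
  -- the field with coefficient `α` of `y ∂/∂y` it is then multiplied by `exp (α t)`.
  have key : ∀ q ∈ orbit 𝔛 M p, (frozenInvariant φ p.1 q).2 = 0 := by
    intro q hq
    suffices q.1 = p.1 ∧ (frozenInvariant φ p.1 q).2 = 0 from this.2
    refine orbit_induction (P := fun q => q.1 = p.1 ∧ (frozenInvariant φ p.1 q).2 = 0)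
      ⟨rfl, ?_⟩ (fun X hX T hT γ h0 hγ => ?_) hq
    · rw [frozenInvariant_apply]
      exact hp
    obtain ⟨α, β, c, δ, hXe⟩ := h.exists_coeff X hX
    have hx : ∀ t ∈ Icc 0 T, (γ t).1 = p.1 := fun t ht => by
      rw [← h0.1]
      refine h.fst_eq_of_mem_orbit (M := M) hM (Relation.ReflTransGen.single
        ⟨X, hX, t, ht.1, γ, rfl, rfl, fun s hs => ?_⟩)
      have hs' : s ∈ Icc 0 T := ⟨hs.1, hs.2.trans ht.2⟩
      exact ⟨(hγ s hs').1, (hγ s hs').2.mono (Icc_subset_Icc_right ht.2)⟩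
    refine ⟨hx T ⟨hT, le_rfl⟩, eq_zero_of_hasDerivWithinAt_mul
      (u := fun t => (frozenInvariant φ p.1 (γ t)).2) (α := α) hT (fun t ht => ?_) h0.2⟩
    have h1 := ((ContinuousLinearMap.snd ℝ ℝ ℝ).comp
      (frozenInvariant φ p.1)).hasFDerivAt.comp_hasDerivWithinAt t (hγ t ht).2
    rw [hXe _ (hM _ (hγ t ht).1)] at h1
    refine h1.congr_deriv ?_
    simp only [ContinuousLinearMap.comp_apply, frozenInvariant_apply, ContinuousLinearMap.coe_snd',
      prolongedVertical, hx t ht]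
    ring
  have := key q hq
  rw [frozenInvariant_apply] at this
  rw [relativeInvariant, h.fst_eq_of_mem_orbit hM hq]
  exact this

/-- Outside the zero set of the relative invariant the fields take every vertical value. -/
theorem exists_prolongedVertical_eq {p v : Jet3} (h2 : iteratedDeriv 2 φ p.1 ≠ 0)
    (hI : relativeInvariant φ p ≠ 0) (hv : v.1 = 0) :
    ∃ α β γ δ : ℝ, prolongedVertical φ α β γ δ p = v := by
  obtain ⟨x, y, y₁, y₂, y₃⟩ := p
  obtain ⟨v₀, a, b, c, d⟩ := v
  simp only [relativeInvariant] at hI h2 hv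
  -- Cramer's rule for the equations of the last two components
  set α := (c * iteratedDeriv 3 φ x - iteratedDeriv 2 φ x * d)
    / (y₂ * iteratedDeriv 3 φ x - iteratedDeriv 2 φ x * y₃) with hα
  have hα' : α * (y₂ * iteratedDeriv 3 φ x - iteratedDeriv 2 φ x * y₃)
      = c * iteratedDeriv 3 φ x - iteratedDeriv 2 φ x * d := div_mul_cancel₀ _ hI
  set δ := (c - α * y₂) / iteratedDeriv 2 φ x with hδ
  have hδ' : δ * iteratedDeriv 2 φ x = c - α * y₂ := div_mul_cancel₀ _ h2
  set γ := b - α * y₁ - δ * iteratedDeriv 1 φ x with hγ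
  refine ⟨α, a - α * y - γ * x - δ * φ x, γ, δ, ?_⟩
  have hd : α * y₃ + δ * iteratedDeriv 3 φ x = d := by
    apply mul_left_cancel₀ h2
    linear_combination iteratedDeriv 3 φ x * hδ' - hα'
  simp only [prolongedVertical, hv, hd]
  ext
  · rfl
  · simp only; ring
  · simp only [hγ]; ring
  · simp only; linarith
  · rfl

theorem isOpen_setOf_base_mem (hV : IsOpen V) : IsOpen {j : Jet3 | j.base ∈ V} :=
  hV.preimage continuous_base

theorem orbitDim_eq_four (h : IsProlongedCanonical 𝔛 V φ) {p : Jet3} (hp : p.base ∈ V)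
    (hI : relativeInvariant φ p ≠ 0) : orbitDim 𝔛 {j : Jet3 | j.base ∈ V} p = 4 := by
  suffices orbitTangent 𝔛 {j : Jet3 | j.base ∈ V} p = LinearMap.ker xComponent.toLinearMap by
    rw [orbitDim_eq_finrank, this, finrank_ker_xComponent]
  refine le_antisymm ?_ fun v hv => ?_
  · exact orbitTangent_le_ker xComponent fun q hq =>
      h.fst_eq_of_mem_orbit (M := {j : Jet3 | j.base ∈ V}) (fun _ hj => hj) hq
  obtain ⟨α, β, γ, δ, hv'⟩ :=
    exists_prolongedVertical_eq (h.second_ne_zero p.1 ⟨p.base, hp, rfl⟩) hI (v := v) hv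
  obtain ⟨X, hX, hXe⟩ := h.exists_field α β γ δ
  obtain ⟨Y, hY, hYe⟩ := h.exists_field (-α) (-β) (-γ) (-δ)
  rw [← hv', ← hXe p hp]
  have hopen := isOpen_setOf_base_mem h.isOpen
  refine apply_mem_orbitTangent hX hY (fun z hz => ?_) hopen hp fun z hz => ?_
  · rw [hXe z hz, hYe z hz]
    simp only [prolongedVertical]
    ext <;> simp <;> ring
  · refine (contDiffAt_prolongedVertical h.analytic α β γ δ hz).congr_of_eventuallyEq ?_
    filter_upwards [hopen.mem_nhds hz] with w hw using hXe w hw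

theorem orbitDim_lt_four (h : IsProlongedCanonical 𝔛 V φ) {p : Jet3} (hp : p.base ∈ V)
    (hI : relativeInvariant φ p = 0) : orbitDim 𝔛 {j : Jet3 | j.base ∈ V} p < 4 := by
  have hM : ∀ j ∈ {j : Jet3 | j.base ∈ V}, j.base ∈ V := fun _ hj => hj
  have hle : orbitTangent 𝔛 {j : Jet3 | j.base ∈ V} p ≤
      LinearMap.ker (frozenInvariant φ p.1).toLinearMap := by
    refine orbitTangent_le_ker _ fun q hq => ?_
    have hx := h.fst_eq_of_mem_orbit hM hq
    have h1 := h.relativeInvariant_eq_zero_of_mem_orbit hM hI hq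
    rw [relativeInvariant, hx] at h1
    rw [relativeInvariant] at hI
    simp only [frozenInvariant_apply, hx, h1, hI]
  have := Submodule.finrank_mono hle
  rw [finrank_ker_frozenInvariant (h.second_ne_zero p.1 ⟨p.base, hp, rfl⟩)] at this
  rw [orbitDim_eq_finrank]
  omega

theorem genericOrbits (h : IsProlongedCanonical 𝔛 V φ) (hne : V.Nonempty) :
    GenericOrbits 𝔛 {j : Jet3 | j.base ∈ V}
      {j : Jet3 | j.base ∈ V ∧ relativeInvariant φ j ≠ 0} 4 := by
  refine ⟨?_, ?_, fun _ hj => hj.1, fun p hp => h.orbitDim_eq_four hp.1 hp.2,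
    fun p hp => h.orbitDim_lt_four hp.1 (by_contra fun hI => hp.2 ⟨hp.1, hI⟩)⟩
  · have hc : ContinuousOn (relativeInvariant φ) {j : Jet3 | j.base ∈ V} := fun j hj => by
      have hit : ∀ n, ContinuousAt (fun i : Jet3 => iteratedDeriv n φ i.1) j := fun n =>
        ContinuousAt.comp (f := Prod.fst) (g := iteratedDeriv n φ)
          (analyticAt_iteratedDeriv h.analytic n (x := j.1) ⟨j.base, hj, rfl⟩).continuousAt
          continuousAt_fst
      have h2 := hit 2
      have h3 := hit 3
      refine ContinuousAt.continuousWithinAt ?_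
      unfold relativeInvariant
      fun_prop
    exact hc.isOpen_inter_preimage (isOpen_setOf_base_mem h.isOpen) isOpen_compl_singleton
  · obtain ⟨⟨x, y⟩, hz⟩ := hne
    refine ⟨(x, y, 0, 0, 1), hz, ?_⟩
    simpa [relativeInvariant] using h.second_ne_zero x ⟨_, hz, rfl⟩

theorem relativeInvariant_eq_zero_iff {p : Jet3} (h2 : iteratedDeriv 2 φ p.1 ≠ 0) :
    relativeInvariant φ p = 0 ↔
      p.2.2.2.2 = iteratedDeriv 3 φ p.1 / iteratedDeriv 2 φ p.1 * p.2.2.2.1 := by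
  rw [relativeInvariant, sub_eq_zero, div_mul_eq_mul_div, eq_div_iff h2]
  constructor <;> intro h <;> linear_combination -h

/-- The element of the algebra whose prolongation fixes the second-order jet of `p` moves `p` along
the fibre of third-order jets, unless the relative invariant vanishes. -/
theorem exists_mem_orbit_toJet2_eq (h : IsProlongedCanonical 𝔛 V φ) {p : Jet3} (hp : p.base ∈ V)
    (hM : ∀ j : Jet3, j.toJet2 = p.toJet2 → j ∈ M) (hI : relativeInvariant φ p ≠ 0) :
    ∃ q ∈ orbit 𝔛 M p, q.toJet2 = p.toJet2 ∧ q.2.2.2.2 ≠ p.2.2.2.2 := by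
  have h2 := h.second_ne_zero p.1 ⟨p.base, hp, rfl⟩
  have hne := (relativeInvariant_eq_zero_iff h2).not.1 hI
  obtain ⟨x, y, y₁, y₂, y₃⟩ := p
  simp only at h2 hne
  set K := iteratedDeriv 3 φ x / iteratedDeriv 2 φ x * y₂ with hK
  obtain ⟨X, hX, hXe⟩ := h.exists_field 1
    (-y + (y₁ - y₂ / iteratedDeriv 2 φ x * iteratedDeriv 1 φ x) * x
      + y₂ / iteratedDeriv 2 φ x * φ x)
    (-y₁ + y₂ / iteratedDeriv 2 φ x * iteratedDeriv 1 φ x) (-y₂ / iteratedDeriv 2 φ x)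
  have hXv : ∀ w : ℝ, X (x, y, y₁, y₂, w) = (0, 0, 0, 0, w - K) := fun w => by
    rw [hXe (x, y, y₁, y₂, w) hp]
    simp only [prolongedVertical, hK]
    ext
    · rfl
    · simp only; ring
    · simp only; ring
    · simp only; field_simp; ring
    · simp only; ring
  have hmem : ∀ w : ℝ, (x, y, y₁, y₂, w) ∈ M := fun w => hM (x, y, y₁, y₂, w) rfl
  refine ⟨(x, y, y₁, y₂, K + (y₃ - K) * Real.exp 1), Relation.ReflTransGen.single
    ⟨X, hX, 1, zero_le_one, fun t => (x, y, y₁, y₂, K + (y₃ - K) * Real.exp t), by simp, rfl,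
      fun t _ => ⟨hmem _, ?_⟩⟩, rfl, fun he => ?_⟩
  · rw [hXv]
    have h1 : HasDerivAt (fun t => K + (y₃ - K) * Real.exp t) (K + (y₃ - K) * Real.exp t - K) t := by
      simpa using ((Real.hasDerivAt_exp t).const_mul (y₃ - K)).const_add K
    exact ((hasDerivAt_const t x).prodMk ((hasDerivAt_const t y).prodMk
      ((hasDerivAt_const t y₁).prodMk
        ((hasDerivAt_const t y₂).prodMk h1)))).hasDerivWithinAt
  · simp only at he
    have : (y₃ - K) * (Real.exp 1 - 1) = 0 := by linear_combination he
    rcases mul_eq_zero.1 this with h0 | h0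
    · exact hne (sub_eq_zero.1 h0)
    · linarith [Real.add_one_lt_exp one_ne_zero]

/-- A hypersurface transversal to the third-order fibres is invariant exactly if the relative
invariant vanishes on it. -/
theorem isInvariantSet_hypersurface_iff (h : IsProlongedCanonical 𝔛 V φ) {D : Set Jet2}
    (hD : ∀ i ∈ D, i.base ∈ V) (f : Jet2 → ℝ) :
    IsInvariantSet 𝔛 {j : Jet3 | j.toJet2 ∈ D} (hypersurface D f) ↔
      ∀ x y y₁ y₂ : ℝ, (x, y, y₁, y₂) ∈ D →
        f (x, y, y₁, y₂) = iteratedDeriv 3 φ x / iteratedDeriv 2 φ x * y₂ := by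
  have hM : ∀ j ∈ {j : Jet3 | j.toJet2 ∈ D}, j.base ∈ V := fun j hj => hD _ hj
  have h2 : ∀ j ∈ {j : Jet3 | j.toJet2 ∈ D}, iteratedDeriv 2 φ j.1 ≠ 0 := fun j hj =>
    h.second_ne_zero j.1 ⟨j.base, hM j hj, rfl⟩
  constructor
  · intro hinv x y y₁ y₂ hi
    by_contra hne
    set p : Jet3 := (x, y, y₁, y₂, f (x, y, y₁, y₂)) with hpdef
    have hpM : p ∈ {j : Jet3 | j.toJet2 ∈ D} := hi
    obtain ⟨q, hq, hq2, hq3⟩ := h.exists_mem_orbit_toJet2_eq (p := p)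
      (M := {j : Jet3 | j.toJet2 ∈ D}) (hM p hpM) (fun j hj => by
        change j.toJet2 ∈ D
        rw [hj]
        exact hi) ((relativeInvariant_eq_zero_iff (h2 p hpM)).not.2 hne)
    have hqH := (hinv.2 p ⟨hi, rfl⟩ hq).2
    rw [hq2] at hqH
    exact hq3 hqH
  · refine fun hf => ⟨fun j hj => hj.1, fun p hp q hq => ?_⟩
    have hqM := orbit_subset (M := {j : Jet3 | j.toJet2 ∈ D}) hp.1 hq
    have hpI : relativeInvariant φ p = 0 :=
      (relativeInvariant_eq_zero_iff (h2 p hp.1)).2 (hp.2.trans (hf _ _ _ _ hp.1))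
    have hqI := h.relativeInvariant_eq_zero_of_mem_orbit hM hpI hq
    exact ⟨hqM, ((relativeInvariant_eq_zero_iff (h2 q hqM)).1 hqI).trans (hf _ _ _ _ hqM).symm⟩

end IsProlongedCanonical

/-! ### Straightening coordinates -/

theorem clm_plane_apply (L : Plane →L[ℝ] ℝ) (w : Plane) :
    L w = w.1 * L (1, 0) + w.2 * L (0, 1) := by
  have : w = w.1 • ((1, 0) : Plane) + w.2 • ((0, 1) : Plane) := by ext <;> simp
  conv_lhs => rw [this, map_add, map_smul, map_smul]
  rfl

/-- Two functionals on the plane are independent if some vector is killed by the first, which is not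
zero, but not by the second. -/
theorem injective_prod_of_apply_eq {A B : Plane →L[ℝ] ℝ} {v : Plane} (hA : A ≠ 0) (hAv : A v = 0)
    (hBv : B v = 1) : Function.Injective (A.prod B) := by
  have hD : A (1, 0) * B (0, 1) - A (0, 1) * B (1, 0) ≠ 0 := fun hD => hA <| by
    rw [clm_plane_apply] at hAv hBv
    have h1 : A (1, 0) = 0 := by
      linear_combination (-A (1, 0)) * hBv + v.2 * hD + B (1, 0) * hAv
    have h2 : A (0, 1) = 0 := by
      linear_combination (-A (0, 1)) * hBv - v.1 * hD + B (0, 1) * hAv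
    refine ContinuousLinearMap.ext fun w => ?_
    rw [clm_plane_apply, h1, h2]
    simp
  refine (injective_iff_map_eq_zero _).2 fun w hw => ?_
  have h1 : A w = 0 := congrArg Prod.fst hw
  have h2 : B w = 0 := congrArg Prod.snd hw
  rw [clm_plane_apply] at h1 h2
  ext
  · apply mul_left_cancel₀ hD
    simp only [Prod.fst_zero]
    linear_combination B (0, 1) * h1 - A (0, 1) * h2
  · apply mul_left_cancel₀ hD
    simp only [Prod.snd_zero]
    linear_combination A (1, 0) * h2 - B (1, 0) * h1

/-- The analytic inverse function theorem in the plane. -/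
theorem exists_analytic_chart {F : Plane → Plane} {O : Set Plane} (hO : IsOpen O)
    (hF : AnalyticOnNhd ℝ F O) (hinj : ∀ z ∈ O, Function.Injective (fderiv ℝ F z)) {z₀ : Plane}
    (hz₀ : z₀ ∈ O) : ∃ e : OpenPartialHomeomorph Plane Plane, z₀ ∈ e.source ∧ e.source ⊆ O ∧
      ⇑e = F ∧ AnalyticOnNhd ℝ e.symm e.target := by
  have hequiv : ∀ z ∈ O, ∃ i : Plane ≃L[ℝ] Plane, (i : Plane →L[ℝ] Plane) = fderiv ℝ F z :=
    fun z hz => ⟨(LinearEquiv.ofInjectiveEndo (fderiv ℝ F z).toLinearMap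
      (hinj z hz)).toContinuousLinearEquiv, by ext <;> rfl⟩
  obtain ⟨i, hi⟩ := hequiv z₀ hz₀
  have hst : HasStrictFDerivAt F (i : Plane →L[ℝ] Plane) z₀ :=
    hi ▸ (hF z₀ hz₀).hasStrictFDerivAt
  set e₀ := hst.toOpenPartialHomeomorph F with he₀
  have hcoe : ⇑e₀ = F := hst.toOpenPartialHomeomorph_coe
  refine ⟨e₀.restrOpen O hO, ⟨hst.mem_toOpenPartialHomeomorph_source, hz₀⟩, inter_subset_right,
    hcoe, fun w hw => ?_⟩
  have hsrc := (e₀.restrOpen O hO).map_target hw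
  set z := (e₀.restrOpen O hO).symm w with hz
  have hwz : w = e₀ z := ((e₀.restrOpen O hO).right_inv hw).symm
  obtain ⟨p, hp⟩ := hF z hsrc.2
  obtain ⟨k, hk⟩ := hequiv z hsrc.2
  rw [hwz]
  refine (e₀.hasFPowerSeriesAt_symm (i := k) (p := p) hsrc.1 (hcoe ▸ hp) ?_).analyticAt
  rw [hk, hp.fderiv_eq]
  simp

/-- A chart may be shrunk to an open subset of its target. -/
theorem exists_restr_target (e : OpenPartialHomeomorph Plane Plane) {B : Set Plane}
    (hB : IsOpen B) (hBe : B ⊆ e.target) : ∃ Φ : OpenPartialHomeomorph Plane Plane,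
      Φ.target = B ∧ Φ.source ⊆ e.source ∧ ⇑Φ = ⇑e ∧ ⇑Φ.symm = ⇑e.symm :=
  ⟨(e.symm.restrOpen B hB).symm, inter_eq_right.2 hBe, inter_subset_left, rfl, rfl⟩

/-- A function whose second derivative vanishes on an interval is affine there. -/
theorem exists_affine_of_iteratedDeriv_two_eq_zero {φ : ℝ → ℝ} {I : Set ℝ} (hI : IsOpen I)
    (hIc : IsPreconnected I) (hφ : AnalyticOnNhd ℝ φ I)
    (h2 : ∀ x ∈ I, iteratedDeriv 2 φ x = 0) : ∃ α β : ℝ, ∀ x ∈ I, φ x = α + β * x := by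
  obtain ⟨β, hβ⟩ := hI.exists_is_const_of_deriv_eq_zero hIc
    (fun x hx => (hφ.deriv x hx).differentiableAt.differentiableWithinAt) fun x hx => by
      have := h2 x hx
      rwa [iteratedDeriv_succ, iteratedDeriv_one] at this
  have hd : ∀ x ∈ I, HasDerivAt (fun x => φ x - β * x) 0 x := fun x hx => by
    have h := (hφ x hx).differentiableAt.hasDerivAt.sub ((hasDerivAt_id x).const_mul β)
    rw [hβ x hx] at h
    simpa using! h
  obtain ⟨α, hα⟩ := hI.exists_is_const_of_deriv_eq_zero hIc
    (fun x hx => (hd x hx).differentiableAt.differentiableWithinAt) fun x hx => (hd x hx).deriv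
  exact ⟨α, β, fun x hx => by linarith [hα x hx]⟩

/-- Straightening coordinates. If `a` and `b` are first integrals of `v`, while `y` has derivative
`1` along `v`, then `(a, y)` are coordinates near a point of `O`, and `b` is a function `φ` of `a`;
the non-degeneracy hypotheses allow the point to be chosen so that `φ''` does not vanish. -/
theorem exists_straightening {O : Set Plane} (hO : IsOpen O) (hne : O.Nonempty)
    {v : Plane → Plane} {a b y : Plane → ℝ} (ha : AnalyticOnNhd ℝ a O)
    (hb : AnalyticOnNhd ℝ b O) (hy : AnalyticOnNhd ℝ y O)
    (hav : ∀ z ∈ O, fderiv ℝ a z (v z) = 0) (hbv : ∀ z ∈ O, fderiv ℝ b z (v z) = 0)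
    (hyv : ∀ z ∈ O, fderiv ℝ y z (v z) = 1)
    (hna : ∀ O' ⊆ O, IsOpen O' → O'.Nonempty → ∀ α : ℝ, ¬ ∀ z ∈ O', a z = α)
    (hnb : ∀ O' ⊆ O, IsOpen O' → O'.Nonempty → ∀ α β : ℝ, ¬ ∀ z ∈ O', b z = α + β * a z) :
    ∃ (Φ : OpenPartialHomeomorph Plane Plane) (φ : ℝ → ℝ), Φ.source.Nonempty ∧ Φ.source ⊆ O ∧
      (∀ z, Φ z = (a z, y z)) ∧ AnalyticOnNhd ℝ Φ.symm Φ.target ∧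
      AnalyticOnNhd ℝ φ (Prod.fst '' Φ.target) ∧
      (∀ x ∈ Prod.fst '' Φ.target, iteratedDeriv 2 φ x ≠ 0) ∧ ∀ z ∈ Φ.source, b z = φ (a z) := by
  obtain ⟨z₀, hz₀, hda⟩ : ∃ z ∈ O, fderiv ℝ a z ≠ 0 := by
    by_contra! hcon
    obtain ⟨z₀, hz₀⟩ := hne
    obtain ⟨r, hr, hball⟩ := Metric.isOpen_iff.1 hO z₀ hz₀
    obtain ⟨α, hα⟩ := Metric.isOpen_ball.exists_is_const_of_fderiv_eq_zero
      (convex_ball z₀ r).isPreconnected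
      (fun z hz => (ha z (hball hz)).differentiableAt.differentiableWithinAt)
      (fun z hz => hcon z (hball hz))
    exact hna _ hball Metric.isOpen_ball ⟨z₀, Metric.mem_ball_self hr⟩ α hα
  -- the points of `O` at which `a` is regular
  have hO₁ : IsOpen {z | z ∈ O ∧ fderiv ℝ a z ≠ 0} :=
    ha.fderiv.continuousOn.isOpen_inter_preimage hO isOpen_compl_singleton
  have hFd : ∀ z ∈ O, HasFDerivAt (fun z => (a z, y z)) ((fderiv ℝ a z).prod (fderiv ℝ y z)) z :=
    fun z hz => (ha z hz).differentiableAt.hasFDerivAt.prodMk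
      (hy z hz).differentiableAt.hasFDerivAt
  obtain ⟨e, hz₀e, heO, hecoe, hesymm⟩ := exists_analytic_chart hO₁
    (fun z hz => (ha z hz.1).prod (hy z hz.1)) (fun z hz => by
      rw [(hFd z hz.1).fderiv]
      exact injective_prod_of_apply_eq hz.2 (hav z hz.1) (hyv z hz.1)) (z₀ := z₀)
    ⟨hz₀, hda⟩
  have heO' : ∀ w ∈ e.target, e.symm w ∈ O := fun w hw => (heO (e.map_target hw)).1
  obtain ⟨r, hr, hball⟩ := Metric.isOpen_iff.1 e.open_target _ (e.map_source hz₀e)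
  set x₀ := (e z₀).1
  set y₀ := (e z₀).2
  have hbox : Metric.ball x₀ r ×ˢ Metric.ball y₀ r ⊆ e.target := by
    rw [ball_prod_same]
    exact hball
  -- `b` has vanishing `y`-derivative in the new coordinates
  have hby : ∀ w ∈ e.target, fderiv ℝ (fun w => b (e.symm w)) w (0, 1) = 0 := fun w hw => by
    have hs := (hesymm w hw).differentiableAt
    have hz := heO' w hw
    have hcomp : HasFDerivAt (fun u => e (e.symm u))
        (((fderiv ℝ a (e.symm w)).prod (fderiv ℝ y (e.symm w))).comp (fderiv ℝ e.symm w)) w := by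
      rw [hecoe]
      exact (hFd _ hz).comp w hs.hasFDerivAt
    have hid : HasFDerivAt (fun u => e (e.symm u)) (ContinuousLinearMap.id ℝ Plane) w :=
      (hasFDerivAt_id w).congr_of_eventuallyEq (by
        filter_upwards [e.open_target.mem_nhds hw] with u hu using e.right_inv hu)
    have hval : fderiv ℝ e.symm w (0, 1) = v (e.symm w) := by
      refine injective_prod_of_apply_eq (heO (e.map_target hw)).2 (hav _ hz) (hyv _ hz) ?_
      have := congrArg (fun L : Plane →L[ℝ] Plane => L (0, 1)) (hcomp.unique hid)
      refine this.trans ?_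
      simp [hav _ hz, hyv _ hz]
    have hbw : HasFDerivAt (fun w => b (e.symm w)) _ w :=
      (hb _ hz).differentiableAt.hasFDerivAt.comp w hs.hasFDerivAt
    rw [hbw.fderiv, ContinuousLinearMap.comp_apply, hval, hbv _ hz]
  set φ : ℝ → ℝ := fun x => b (e.symm (x, y₀)) with hφ
  have hy₀ : y₀ ∈ Metric.ball y₀ r := Metric.mem_ball_self hr
  have hbφ : ∀ x ∈ Metric.ball x₀ r, ∀ t ∈ Metric.ball y₀ r, b (e.symm (x, t)) = φ x := by
    intro x hx t ht
    have hd : ∀ s ∈ Metric.ball y₀ r, HasDerivAt (fun s => b (e.symm (x, s))) 0 s :=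
      fun s hs => by
      have hw : (x, s) ∈ e.target := hbox ⟨hx, hs⟩
      have h1 : HasFDerivAt (fun w => b (e.symm w)) _ (x, s) :=
        ((hb _ (heO' _ hw)).comp (hesymm _ hw)).differentiableAt.hasFDerivAt
      have h2 := h1.comp_hasDerivAt s ((hasDerivAt_const s x).prodMk (hasDerivAt_id s))
      exact h2.congr_deriv (hby _ hw)
    exact Metric.isOpen_ball.is_const_of_deriv_eq_zero (convex_ball y₀ r).isPreconnected
      (fun s hs => (hd s hs).differentiableAt.differentiableWithinAt)
      (fun s hs => (hd s hs).deriv) ht hy₀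
  have hφan : AnalyticOnNhd ℝ φ (Metric.ball x₀ r) := fun x hx => by
    have hw : (x, y₀) ∈ e.target := hbox ⟨hx, hy₀⟩
    exact AnalyticAt.comp (f := fun x => (x, y₀)) (g := fun w => b (e.symm w))
      ((hb _ (heO' _ hw)).comp (hesymm _ hw)) (analyticAt_id.prod analyticAt_const)
  have hdec : ∀ z ∈ e.source, e z ∈ Metric.ball x₀ r ×ˢ Metric.ball y₀ r → b z = φ (a z) := by
    intro z hz hzb
    have h1 := hbφ _ hzb.1 _ hzb.2
    rw [Prod.mk.eta, e.left_inv hz, hecoe] at h1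
    exact h1
  obtain ⟨x₁, hx₁, hφ₁⟩ : ∃ x ∈ Metric.ball x₀ r, iteratedDeriv 2 φ x ≠ 0 := by
    by_contra! hcon
    obtain ⟨α, β, hαβ⟩ := exists_affine_of_iteratedDeriv_two_eq_zero Metric.isOpen_ball
      (convex_ball x₀ r).isPreconnected hφan hcon
    refine hnb (e.source ∩ e ⁻¹' (Metric.ball x₀ r ×ˢ Metric.ball y₀ r))
      (fun z hz => (heO hz.1).1)
      (e.isOpen_inter_preimage (Metric.isOpen_ball.prod Metric.isOpen_ball))
      ⟨z₀, hz₀e, Metric.mem_ball_self hr, hy₀⟩ α β fun z hz => ?_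
    rw [hdec z hz.1 hz.2]
    have h1 := hαβ _ hz.2.1
    rw [hecoe] at h1
    exact h1
  have hIopen : IsOpen (Metric.ball x₀ r ∩ iteratedDeriv 2 φ ⁻¹' {0}ᶜ) := by
    refine ContinuousOn.isOpen_inter_preimage (fun x hx => ?_) Metric.isOpen_ball
      isOpen_compl_singleton
    rw [iteratedDeriv_eq_iterate]
    exact (hφan.iterated_deriv 2 x hx).continuousAt.continuousWithinAt
  set I := Metric.ball x₀ r ∩ iteratedDeriv 2 φ ⁻¹' {0}ᶜ with hIdef
  obtain ⟨Φ, hΦt, hΦs, hΦ, hΦsymm⟩ := exists_restr_target e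
    (hIopen.prod (Metric.isOpen_ball (x := y₀) (ε := r)))
    (fun w hw => hbox ⟨hw.1.1, hw.2⟩)
  have himg : Prod.fst '' Φ.target ⊆ I := by
    rw [hΦt]
    rintro _ ⟨w, hw, rfl⟩
    exact hw.1
  refine ⟨Φ, φ, ⟨Φ.symm (x₁, y₀), Φ.map_target (hΦt ▸ ⟨⟨hx₁, hφ₁⟩, hy₀⟩)⟩,
    fun z hz => (heO (hΦs hz)).1, fun z => by rw [hΦ, hecoe], ?_,
    fun x hx => hφan x (himg hx).1, fun x hx => (himg hx).2, fun z hz => ?_⟩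
  · rw [hΦsymm, hΦt]
    exact fun w hw => hesymm w (hbox ⟨hw.1.1, hw.2⟩)
  · have h1 := Φ.map_source hz
    rw [hΦt, hΦ] at h1
    exact hdec z (hΦs hz) ⟨h1.1.1, h1.2⟩

/-! ### Proportional fields and the structure of the Lie algebra -/

/-- The coefficient `f` with `Y = f X`, for fields that are everywhere proportional. It is the
Euclidean projection coefficient, so that it is visibly analytic where `X` has no zeros; at the
zeros of `X` it has the junk value `0`. -/
noncomputable def ratio (X Y : Plane → Plane) (z : Plane) : ℝ :=
  ((Y z).1 * (X z).1 + (Y z).2 * (X z).2) / ((X z).1 ^ 2 + (X z).2 ^ 2)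

theorem sq_add_sq_ne_zero {w : Plane} (hw : w ≠ 0) : w.1 ^ 2 + w.2 ^ 2 ≠ 0 := fun h => hw <| by
  have h1 : w.1 = 0 := by nlinarith [sq_nonneg w.1, sq_nonneg w.2]
  have h2 : w.2 = 0 := by nlinarith [sq_nonneg w.1, sq_nonneg w.2]
  exact Prod.ext h1 h2

theorem ratio_smul {X Y : Plane → Plane} {z : Plane} (hX : X z ≠ 0)
    (h : (X z).1 * (Y z).2 - (X z).2 * (Y z).1 = 0) : Y z = ratio X Y z • X z := by
  have h0 := sq_add_sq_ne_zero hX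
  ext
  · simp only [ratio, Prod.smul_fst, smul_eq_mul]
    field_simp
    linear_combination (-(X z).2) * h
  · simp only [ratio, Prod.smul_snd, smul_eq_mul]
    field_simp
    linear_combination (X z).1 * h

theorem analyticAt_ratio {X Y : Plane → Plane} {z : Plane} (hX : AnalyticAt ℝ X z)
    (hY : AnalyticAt ℝ Y z) (h0 : X z ≠ 0) : AnalyticAt ℝ (ratio X Y) z := by
  have hX1 := analyticAt_fst.comp hX
  have hX2 := analyticAt_snd.comp hX
  have hY1 := analyticAt_fst.comp hY
  have hY2 := analyticAt_snd.comp hY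
  exact ((hY1.mul hX1).add (hY2.mul hX2)).div ((hX1.pow 2).add (hX2.pow 2))
    (sq_add_sq_ne_zero h0)

/-- `[r V, f V] = (r V(f) - f V(r)) V`. -/
theorem lieBracket_smul_smul {V X Y : Plane → Plane} {r f : Plane → ℝ} {z : Plane}
    (hV : DifferentiableAt ℝ V z) (hr : DifferentiableAt ℝ r z) (hf : DifferentiableAt ℝ f z)
    (hX : X =ᶠ[nhds z] fun w => r w • V w) (hY : Y =ᶠ[nhds z] fun w => f w • V w) :
    VectorField.lieBracket ℝ X Y z
      = (r z * fderiv ℝ f z (V z) - f z * fderiv ℝ r z (V z)) • V z := by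
  rw [hX.lieBracket_vectorField_eq hY,
    VectorField.lieBracket_smul_right (V := fun w => r w • V w) hf hV,
    VectorField.lieBracket_smul_left hr hV, VectorField.lieBracket_self]
  simp only [map_smul, smul_eq_mul, Pi.zero_apply, smul_zero, add_zero, smul_smul]
  module

namespace AnalyticVF

variable {U : TopologicalSpace.Opens Plane}

/-- The identity theorem for analytic vector fields. -/
theorem eq_zero_of_eqOn (hU : IsConnected (U : Set Plane)) (X : AnalyticVF U) {O : Set Plane}
    (hO : IsOpen O) (hne : O.Nonempty) (hOU : O ⊆ U) (h : ∀ z ∈ O, X z = 0) : X = 0 := by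
  obtain ⟨z₀, hz₀⟩ := hne
  refine ext_on fun z hz => ?_
  exact AnalyticOnNhd.eqOn_zero_of_preconnected_of_eventuallyEq_zero X.2.1 hU.isPreconnected
    (hOU hz₀) (by filter_upwards [hO.mem_nhds hz₀] with w hw using h w hw) hz

end AnalyticVF

/-- Fields of an algebra of rank `1` are everywhere proportional: where two of them were
independent, the orbit would be two-dimensional. -/
theorem det_eq_zero_of_hasRank_one {U : TopologicalSpace.Opens Plane}
    {g : LieSubalgebra ℝ (AnalyticVF U)} (h : HasRank (fieldsOf g) (U : Set Plane) 1)
    {X Y : AnalyticVF U} (hX : X ∈ g) (hY : Y ∈ g) {z : Plane} (hz : z ∈ U) :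
    (X z).1 * (Y z).2 - (X z).2 * (Y z).1 = 0 := by
  by_contra hD
  have hmem : ∀ Z ∈ g, (Z : AnalyticVF U) z ∈ orbitTangent (fieldsOf g) (U : Set Plane) z :=
    fun Z hZ => apply_mem_orbitTangent ⟨Z, hZ, rfl⟩ ⟨-Z, g.neg_mem hZ, rfl⟩
      (fun w _ => by
        have : -Z = (-1 : ℝ) • Z := by simp
        rw [this, AnalyticVF.coe_smul]
        simp) U.isOpen hz fun _ hw => (Z.analyticAt hw).contDiffAt
  have htop : orbitTangent (fieldsOf g) (U : Set Plane) z = ⊤ := by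
    refine eq_top_iff.2 fun w _ => ?_
    have hw : ((X z).1 * (Y z).2 - (X z).2 * (Y z).1) • w
        = (w.1 * (Y z).2 - w.2 * (Y z).1) • X z + ((X z).1 * w.2 - (X z).2 * w.1) • Y z := by
      ext
      · simp only [Prod.fst_add, Prod.smul_fst, smul_eq_mul]
        ring
      · simp only [Prod.snd_add, Prod.smul_snd, smul_eq_mul]
        ring
    rw [← Submodule.smul_mem_iff _ hD, hw]
    exact Submodule.add_mem _ (Submodule.smul_mem _ _ (hmem X hX))
      (Submodule.smul_mem _ _ (hmem Y hY))
  obtain ⟨W, -, -, -, h1, h0⟩ := h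
  have h2 : orbitDim (fieldsOf g) (U : Set Plane) z = 2 := by
    rw [orbitDim_eq_finrank, htop, finrank_top]
    simp
  by_cases hzW : z ∈ W
  · have := h1 z hzW
    omega
  · have := h0 z ⟨hz, hzW⟩
    omega

section Algebra

variable {L : Type*} [LieRing L] [LieAlgebra ℝ L] {q : L} {c : ℝ}

/-- In a four-dimensional Lie algebra with abelian commutator ideal, on which `ad q` has a
generalised eigenspace of dimension `3`, the commutator ideal is no larger than this eigenspace:
otherwise it would be the whole algebra, which would then be abelian, with commutator ideal `0`. -/
theorem finrank_derived_eq_three (hdim : Module.finrank ℝ L = 4)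
    (habel : IsLieAbelian (⁅(⊤ : LieIdeal ℝ L), (⊤ : LieIdeal ℝ L)⁆ : LieIdeal ℝ L))
    (heig : Module.finrank ℝ ((LieModule.toEnd ℝ L
      (⁅(⊤ : LieIdeal ℝ L), (⊤ : LieIdeal ℝ L)⁆ : LieIdeal ℝ L) q).maxGenEigenspace c) = 3) :
    Module.finrank ℝ (⁅(⊤ : LieIdeal ℝ L), (⊤ : LieIdeal ℝ L)⁆ : LieIdeal ℝ L) = 3 := by
  have : FiniteDimensional ℝ L := FiniteDimensional.of_finrank_pos (by omega)
  set I : LieIdeal ℝ L := ⁅(⊤ : LieIdeal ℝ L), (⊤ : LieIdeal ℝ L)⁆ with hI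
  have h3 : 3 ≤ Module.finrank ℝ I := heig ▸ Submodule.finrank_le _
  have h4 : Module.finrank ℝ I ≤ 4 := hdim ▸ Submodule.finrank_le I.toSubmodule
  refine le_antisymm (Nat.le_of_lt_succ (lt_of_le_of_ne h4 fun h => ?_)) h3
  have htop : I = ⊤ := by
    rw [← LieSubmodule.toSubmodule_eq_top]
    exact Submodule.eq_top_of_finrank_eq (h.trans hdim.symm)
  have hbot : I = ⊥ := by
    rw [hI, LieSubmodule.lie_eq_bot_iff]
    intro x _ y _
    have hx : x ∈ I := htop ▸ LieSubmodule.mem_top x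
    have hy : y ∈ I := htop ▸ LieSubmodule.mem_top y
    exact congrArg Subtype.val (habel.trivial ⟨x, hx⟩ ⟨y, hy⟩)
  have h0 : Module.finrank ℝ (⊥ : LieIdeal ℝ L) = 0 := finrank_bot ℝ L
  rw [hbot] at h3
  omega

/-- If moreover `c ≠ 0`, then `q` spans a complement of the commutator ideal. -/
theorem exists_smul_add_of_derived (hdim : Module.finrank ℝ L = 4) (hc : c ≠ 0)
    (habel : IsLieAbelian (⁅(⊤ : LieIdeal ℝ L), (⊤ : LieIdeal ℝ L)⁆ : LieIdeal ℝ L))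
    (heig : Module.finrank ℝ ((LieModule.toEnd ℝ L
      (⁅(⊤ : LieIdeal ℝ L), (⊤ : LieIdeal ℝ L)⁆ : LieIdeal ℝ L) q).maxGenEigenspace c) = 3)
    (x : L) : ∃ s : ℝ, ∃ v ∈ (⁅(⊤ : LieIdeal ℝ L), (⊤ : LieIdeal ℝ L)⁆ : LieIdeal ℝ L),
      x = s • q + v := by
  have : FiniteDimensional ℝ L := FiniteDimensional.of_finrank_pos (by omega)
  have h3 := finrank_derived_eq_three hdim habel heig
  set I : LieIdeal ℝ L := ⁅(⊤ : LieIdeal ℝ L), (⊤ : LieIdeal ℝ L)⁆ with hI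
  have hq : q ∉ I := fun hq => by
    have h0 : LieModule.toEnd ℝ L I q = 0 := by
      ext w
      exact congrArg Subtype.val (habel.trivial ⟨q, hq⟩ w)
    have hbot : (LieModule.toEnd ℝ L I q).maxGenEigenspace c = ⊥ := by
      refine (Submodule.eq_bot_iff _).2 fun w hw => ?_
      rw [h0, Module.End.mem_maxGenEigenspace] at hw
      obtain ⟨k, hk⟩ := hw
      rw [zero_sub, ← neg_smul, smul_pow, one_pow, LinearMap.smul_apply] at hk
      exact (smul_eq_zero.1 hk).resolve_left (pow_ne_zero _ (neg_ne_zero.2 hc))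
    rw [hbot] at heig
    simp at heig
  have hlt : I.toSubmodule < Submodule.span ℝ {q} ⊔ I.toSubmodule :=
    lt_of_le_of_ne le_sup_right fun he => hq <| by
      change q ∈ I.toSubmodule
      rw [he]
      exact Submodule.mem_sup_left (Submodule.mem_span_singleton_self q)
  have h4 := Submodule.finrank_lt_finrank_of_lt hlt
  have htop : Submodule.span ℝ {q} ⊔ I.toSubmodule = ⊤ := by
    refine Submodule.eq_top_of_finrank_eq (le_antisymm (Submodule.finrank_le _) ?_)
    have h3' : Module.finrank ℝ I.toSubmodule = 3 := h3
    omega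
  obtain ⟨u, hu, v, hv, rfl⟩ := Submodule.mem_sup.1 (htop ▸ Submodule.mem_top : x ∈ _)
  obtain ⟨s, rfl⟩ := Submodule.mem_span_singleton.1 hu
  exact ⟨s, v, hv, rfl⟩

end Algebra

/-- If `ad q` acts at `z` on the values of the fields of `g'` as multiplication by a scalar, this
scalar is the generalised eigenvalue of `ad q`. -/
theorem eq_of_maxGenEigenspace_eq_top {U : TopologicalSpace.Opens Plane}
    {g : LieSubalgebra ℝ (AnalyticVF U)} {q : g} {c : ℝ}
    (htop : (LieModule.toEnd ℝ g (commutatorIdeal g) q).maxGenEigenspace c = ⊤)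
    {z : Plane} {m : ℝ}
    (hm : ∀ w : commutatorIdeal g,
      ((⁅q, w⁆ : commutatorIdeal g) : AnalyticVF U) z = m • ((w : g) : AnalyticVF U) z)
    (w : commutatorIdeal g) (hw : ((w : g) : AnalyticVF U) z ≠ 0) : m = c := by
  obtain ⟨k, hk⟩ := (Module.End.mem_maxGenEigenspace _ _ _).1 (htop ▸ Submodule.mem_top : w ∈ _)
  set T : Module.End ℝ (commutatorIdeal g) :=
    LieModule.toEnd ℝ g (commutatorIdeal g) q - c • (1 : Module.End ℝ (commutatorIdeal g)) with hT
  have hTw : ∀ u : commutatorIdeal g,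
      ((T u : g) : AnalyticVF U) z = (m - c) • ((u : g) : AnalyticVF U) z := fun u => by
    have h1 : T u = ⁅q, u⁆ + (-c) • u := by
      simp [hT, sub_eq_add_neg]
    rw [h1, sub_smul, ← hm u, sub_eq_add_neg, ← neg_smul]
    rfl
  have hpow : ∀ k : ℕ, (((T ^ k) w : g) : AnalyticVF U) z
      = (m - c) ^ k • ((w : g) : AnalyticVF U) z := fun k => by
    induction k with
    | zero => simp
    | succ k ih => rw [pow_succ', Module.End.mul_apply, hTw, ih, pow_succ', mul_smul]
  have h0 := hpow k
  rw [hk] at h0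
  have h1 : (m - c) ^ k • ((w : g) : AnalyticVF U) z = 0 := h0.symm
  exact sub_eq_zero.1 (eq_zero_of_pow_eq_zero ((smul_eq_zero.1 h1).resolve_right hw))

/-! ### Canonical charts -/

/-- The change of coordinates `inCoords Φ` as a linear map on the fields. -/
noncomputable def inCoordsLinear (Φ : OpenPartialHomeomorph Plane Plane) :
    (Plane → Plane) →ₗ[ℝ] Plane → Plane where
  toFun := inCoords Φ
  map_add' X Y := by
    rw [inCoords, inCoords, inCoords, ← indicator_add']
    congr 1
    ext1 z
    exact map_add _ _ _
  map_smul' c X := by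
    funext z
    by_cases hz : z ∈ Φ.target <;> simp [inCoords, hz]

theorem inCoords_eq_vertical {Φ : OpenPartialHomeomorph Plane Plane} {a y f : Plane → ℝ}
    {v X : Plane → Plane} {h : ℝ → ℝ → ℝ} (hΦ : ∀ z, Φ z = (a z, y z))
    (ha : AnalyticOnNhd ℝ a Φ.source) (hy : AnalyticOnNhd ℝ y Φ.source)
    (hav : ∀ z ∈ Φ.source, fderiv ℝ a z (v z) = 0) (hyv : ∀ z ∈ Φ.source, fderiv ℝ y z (v z) = 1)
    (hX : ∀ z ∈ Φ.source, X z = f z • v z) (hf : ∀ z ∈ Φ.source, f z = h (a z) (y z)) :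
    inCoords Φ X = vertical Φ.target h := by
  refine indicator_congr fun w hw => ?_
  have hz := Φ.map_target hw
  have hd : HasFDerivAt Φ ((fderiv ℝ a (Φ.symm w)).prod (fderiv ℝ y (Φ.symm w))) (Φ.symm w) := by
    rw [show ⇑Φ = fun z => (a z, y z) from funext hΦ]
    exact (ha _ hz).differentiableAt.hasFDerivAt.prodMk (hy _ hz).differentiableAt.hasFDerivAt
  have hw' : w = (a (Φ.symm w), y (Φ.symm w)) := by rw [← hΦ, Φ.right_inv hw]
  rw [hd.fderiv, hX _ hz, map_smul, ContinuousLinearMap.prod_apply, hav _ hz, hyv _ hz, hf _ hz]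
  conv_rhs => rw [hw']
  simp

section Algebra

variable {U : TopologicalSpace.Opens Plane} {g : LieSubalgebra ℝ (AnalyticVF U)}

/-- The inclusion of a Lie algebra of fields into all fields on the plane. -/
def fieldsLinear (g : LieSubalgebra ℝ (AnalyticVF U)) : g →ₗ[ℝ] Plane → Plane where
  toFun X := ⇑(X : AnalyticVF U)
  map_add' _ _ := rfl
  map_smul' _ _ := rfl

theorem fieldsOf_eq_image : fieldsOf g = fieldsLinear g '' (⊤ : Submodule ℝ g) := by
  ext X
  constructor
  · rintro ⟨Y, hY, rfl⟩
    exact ⟨⟨Y, hY⟩, trivial, rfl⟩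
  · rintro ⟨Y, -, rfl⟩
    exact ⟨Y, Y.2, rfl⟩

theorem commutatorFieldsOf_eq_image :
    commutatorFieldsOf g = fieldsLinear g '' (commutatorIdeal g).toSubmodule := by
  ext X
  constructor
  · rintro ⟨Y, hY, rfl⟩
    exact ⟨Y, hY, rfl⟩
  · rintro ⟨Y, hY, rfl⟩
    exact ⟨Y, hY, rfl⟩

theorem commutatorIdeal_eq_span (v : Module.Basis (Fin 3) ℝ (commutatorIdeal g)) :
    (commutatorIdeal g).toSubmodule = Submodule.span ℝ {(v 0 : g), (v 1 : g), (v 2 : g)} := by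
  have h := congrArg (Submodule.map (commutatorIdeal g).toSubmodule.subtype) v.span_eq
  rw [Submodule.map_span, Submodule.map_top, Submodule.range_subtype] at h
  rw [← h]
  congr 1
  ext x
  simp only [mem_image, mem_range, Fin.exists_fin_succ, mem_insert_iff,
    mem_singleton_iff]
  simp [eq_comm]

variable {v : Module.Basis (Fin 3) ℝ (commutatorIdeal g)}

theorem eq_zero_of_apply_eq_zero (hU : IsConnected (U : Set Plane)) {w : commutatorIdeal g}
    {O : Set Plane} (hO : IsOpen O) (hne : O.Nonempty) (hOU : O ⊆ U)
    (h : ∀ z ∈ O, ((w : g) : AnalyticVF U) z = 0) : w = 0 :=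
  Subtype.ext (Subtype.ext (AnalyticVF.eq_zero_of_eqOn hU _ hO hne hOU h))

theorem eventuallyEq_ratio_smul (hrank : HasRank (fieldsOf g) (U : Set Plane) 1) {X Y : g}
    {z : Plane} (hz : z ∈ U) (hX : (X : AnalyticVF U) z ≠ 0) :
    (⇑(Y : AnalyticVF U)) =ᶠ[nhds z] fun w =>
      ratio (X : AnalyticVF U) (Y : AnalyticVF U) w • (X : AnalyticVF U) w := by
  filter_upwards [U.isOpen.mem_nhds hz,
    ((X : AnalyticVF U).analyticAt hz).continuousAt.eventually_ne hX] with w hw hXw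
  exact ratio_smul hXw (det_eq_zero_of_hasRank_one hrank X.2 Y.2 hw)

variable {u : commutatorIdeal g} {z : Plane}

/-- Since `g'` is abelian, quotients of its fields are first integrals of them. -/
theorem fderiv_ratio_eq_zero (hrank : HasRank (fieldsOf g) (U : Set Plane) 1)
    (habel : IsLieAbelian (commutatorIdeal g)) (hz : z ∈ U)
    (hu : ((u : g) : AnalyticVF U) z ≠ 0) (w : commutatorIdeal g) :
    fderiv ℝ (ratio ((u : g) : AnalyticVF U) ((w : g) : AnalyticVF U)) z
      (((u : g) : AnalyticVF U) z) = 0 := by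
  have hlie : (⁅((u : g) : AnalyticVF U), ((w : g) : AnalyticVF U)⁆ : AnalyticVF U) = 0 :=
    congrArg (fun x : commutatorIdeal g => ((x : g) : AnalyticVF U)) (habel.trivial u w)
  have hua := ((u : g) : AnalyticVF U).analyticAt hz
  have hwa := ((w : g) : AnalyticVF U).analyticAt hz
  have h := AnalyticVF.lie_apply ((u : g) : AnalyticVF U) ((w : g) : AnalyticVF U) hz
  rw [hlie, lieBracket_smul_smul (r := fun _ => 1) hua.differentiableAt
    (differentiableAt_const _) (analyticAt_ratio hua hwa hu).differentiableAt (by simp)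
    (eventuallyEq_ratio_smul hrank hz hu)] at h
  have h' := (smul_eq_zero.1 h.symm).resolve_right hu
  simpa using h'

/-- Along `u ∈ g'` the quotient of `q` by `u` has derivative `-c`, where `c` is the generalised
eigenvalue of `ad q` on `g'`: up to the factor `-1/c` it is a coordinate in which `u = ∂/∂y`. -/
theorem fderiv_ratio_eq_neg (hrank : HasRank (fieldsOf g) (U : Set Plane) 1)
    (habel : IsLieAbelian (commutatorIdeal g)) (hz : z ∈ U)
    (hu : ((u : g) : AnalyticVF U) z ≠ 0) {q : g} {c : ℝ}
    (htop : (LieModule.toEnd ℝ g (commutatorIdeal g) q).maxGenEigenspace c = ⊤) :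
    fderiv ℝ (ratio ((u : g) : AnalyticVF U) (q : AnalyticVF U)) z
      (((u : g) : AnalyticVF U) z) = -c := by
  have hua := ((u : g) : AnalyticVF U).analyticAt hz
  have hqa := (q : AnalyticVF U).analyticAt hz
  refine neg_eq_iff_eq_neg.1 (eq_of_maxGenEigenspace_eq_top htop (z := z) (fun w => ?_) u hu)
  have hwa := ((w : g) : AnalyticVF U).analyticAt hz
  refine (AnalyticVF.lie_apply (q : AnalyticVF U) ((w : g) : AnalyticVF U) hz).trans ?_
  rw [lieBracket_smul_smul hua.differentiableAt (analyticAt_ratio hua hqa hu).differentiableAt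
    (analyticAt_ratio hua hwa hu).differentiableAt (eventuallyEq_ratio_smul hrank hz hu)
    (eventuallyEq_ratio_smul hrank hz hu), fderiv_ratio_eq_zero hrank habel hz hu w,
    (eventuallyEq_ratio_smul hrank (Y := (w : g)) hz hu).eq_of_nhds, smul_smul]
  congr 1
  ring

/-- Every nonempty open subset of `U` meets the domain of a canonical chart adapted to `v`. -/
theorem exists_canonicalChart (hU : IsConnected (U : Set Plane))
    (hdim : Module.finrank ℝ g = 4) (hrank : HasRank (fieldsOf g) (U : Set Plane) 1)
    (habel : IsLieAbelian (commutatorIdeal g)) {q : g} {c : ℝ} (hc : c ≠ 0)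
    (heig : Module.finrank ℝ
      ((LieModule.toEnd ℝ g (commutatorIdeal g) q).maxGenEigenspace c) = 3)
    (v : Module.Basis (Fin 3) ℝ (commutatorIdeal g)) {O : Set Plane} (hO : IsOpen O)
    (hne : O.Nonempty) (hOU : O ⊆ U) :
    ∃ (Φ : OpenPartialHomeomorph Plane Plane) (φ : ℝ → ℝ), Φ.source ⊆ O ∧
      IsCanonicalChart g Φ φ ∧
      inCoords Φ ((v 0 : g) : AnalyticVF U) = vertical Φ.target (fun _ _ => 1) ∧
      inCoords Φ ((v 1 : g) : AnalyticVF U) = vertical Φ.target (fun x _ => x) ∧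
      inCoords Φ ((v 2 : g) : AnalyticVF U) = vertical Φ.target (fun x _ => φ x) := by
  have h3 : Module.finrank ℝ (commutatorIdeal g) = 3 := finrank_derived_eq_three hdim habel heig
  have htop : (LieModule.toEnd ℝ g (commutatorIdeal g) q).maxGenEigenspace c = ⊤ := by
    have : FiniteDimensional ℝ (commutatorIdeal g) := FiniteDimensional.of_finrank_pos (by omega)
    exact Submodule.eq_top_of_finrank_eq (heig.trans h3.symm)
  set V : Fin 3 → AnalyticVF U := fun i => ((v i : g) : AnalyticVF U) with hV
  -- the part of `O` on which the first basis field has no zeros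
  set P : Set Plane := O ∩ ⇑(V 0) ⁻¹' {0}ᶜ with hP
  have hPo : IsOpen P := ContinuousOn.isOpen_inter_preimage
    (fun z hz => ((V 0).analyticAt (hOU hz)).continuousAt.continuousWithinAt) hO
    isOpen_compl_singleton
  have hPne : P.Nonempty := by
    by_contra hcon
    refine v.ne_zero 0 (eq_zero_of_apply_eq_zero hU hO hne hOU fun z hz => ?_)
    by_contra h0
    exact hcon ⟨z, hz, h0⟩
  have hPU : ∀ z ∈ P, z ∈ U := fun z hz => hOU hz.1
  have hsmul : ∀ (Y : g), ∀ z ∈ P, (Y : AnalyticVF U) z = ratio (V 0) (Y : AnalyticVF U) z • V 0 z :=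
    fun Y z hz => (eventuallyEq_ratio_smul hrank (hPU z hz) hz.2).eq_of_nhds
  have han : ∀ Y : g, AnalyticOnNhd ℝ (ratio (V 0) (Y : AnalyticVF U)) P := fun Y z hz =>
    analyticAt_ratio ((V 0).analyticAt (hPU z hz)) ((Y : AnalyticVF U).analyticAt (hPU z hz)) hz.2
  set a := ratio (V 0) (V 1)
  set b := ratio (V 0) (V 2)
  -- the multiple of `q` that is to become `y ∂/∂y`
  set e : g := (-c⁻¹) • q with he
  set y : Plane → ℝ := fun z => (-c⁻¹) * ratio (V 0) (q : AnalyticVF U) z with hy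
  have hey : ∀ z ∈ P, (e : AnalyticVF U) z = y z • V 0 z := fun z hz => by
    change (-c⁻¹) • (q : AnalyticVF U) z = _
    rw [hsmul q z hz, smul_smul]
  have hya : AnalyticOnNhd ℝ y P := fun z hz => analyticAt_const.mul (han q z hz)
  have hav : ∀ z ∈ P, fderiv ℝ a z (V 0 z) = 0 := fun z hz =>
    fderiv_ratio_eq_zero hrank habel (hPU z hz) hz.2 (v 1)
  have hbv : ∀ z ∈ P, fderiv ℝ b z (V 0 z) = 0 := fun z hz =>
    fderiv_ratio_eq_zero hrank habel (hPU z hz) hz.2 (v 2)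
  have hyv : ∀ z ∈ P, fderiv ℝ y z (V 0 z) = 1 := fun z hz => by
    rw [hy, fderiv_const_mul (han q z hz).differentiableAt, smul_apply,
      fderiv_ratio_eq_neg hrank habel (hPU z hz) hz.2 htop, smul_eq_mul, neg_mul_neg,
      inv_mul_cancel₀ hc]
  obtain ⟨Φ, φ, hΦne, hΦP, hΦ, hΦsymm, hφ, hφ2, hbφ⟩ := exists_straightening hPo hPne
    (han _) (han _) hya hav hbv hyv (a := a) (b := b)
    (fun O' hO'P hO' hO'ne α hα => by
      have h0 : v 1 - α • v 0 = 0 := eq_zero_of_apply_eq_zero hU hO' hO'ne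
        (fun z hz => hPU z (hO'P hz)) fun z hz => by
          change V 1 z + -(α • V 0 z) = 0
          rw [hsmul (v 1) z (hO'P hz), ← hα z hz, add_neg_cancel]
      have := congrArg (fun u => v.repr u 1) h0
      simp at this)
    (fun O' hO'P hO' hO'ne α β hαβ => by
      have h0 : v 2 - (α • v 0 + β • v 1) = 0 := eq_zero_of_apply_eq_zero hU hO' hO'ne
        (fun z hz => hPU z (hO'P hz)) fun z hz => by
          change V 2 z + -(α • V 0 z + β • V 1 z) = 0
          have h1 := hsmul (v 1) z (hO'P hz)
          have h2 := hsmul (v 2) z (hO'P hz)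
          change V 1 z = a z • V 0 z at h1
          change V 2 z = b z • V 0 z at h2
          rw [h1, h2, hαβ z hz]
          module
      have := congrArg (fun u => v.repr u 2) h0
      simp at this)
  have hcoord : ∀ {X : Plane → Plane} {f : Plane → ℝ} {h : ℝ → ℝ → ℝ},
      (∀ z ∈ P, X z = f z • V 0 z) → (∀ z ∈ Φ.source, f z = h (a z) (y z)) →
        inCoords Φ X = vertical Φ.target h := fun hX hf =>
    inCoords_eq_vertical hΦ (fun z hz => han _ z (hΦP hz)) (fun z hz => hya z (hΦP hz))
      (fun z hz => hav z (hΦP hz)) (fun z hz => hyv z (hΦP hz)) (fun z hz => hX z (hΦP hz)) hf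
  have hE : inCoords Φ (e : AnalyticVF U) = vertical Φ.target (fun _ y => y) :=
    hcoord hey fun _ _ => rfl
  have hV0 : inCoords Φ (V 0) = vertical Φ.target (fun _ _ => 1) :=
    hcoord (f := fun _ => 1) (fun _ _ => (one_smul _ _).symm) fun _ _ => rfl
  have hV1 : inCoords Φ (V 1) = vertical Φ.target (fun x _ => x) :=
    hcoord (hsmul (v 1)) fun _ _ => rfl
  have hV2 : inCoords Φ (V 2) = vertical Φ.target (fun x _ => φ x) :=
    hcoord (hsmul (v 2)) hbφ
  have hspan := commutatorIdeal_eq_span v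
  have hspan' : (⊤ : Submodule ℝ g) = Submodule.span ℝ {e, (v 0 : g), (v 1 : g), (v 2 : g)} := by
    refine (eq_top_iff.2 fun x _ => ?_).symm
    obtain ⟨s, w, hw, rfl⟩ := exists_smul_add_of_derived hdim hc habel heig x
    refine Submodule.mem_span_insert.2 ⟨-(c * s), w, hspan ▸ hw, ?_⟩
    rw [he, smul_smul]
    congr 2
    field_simp
  have himage : ∀ S : Set g, inCoords Φ '' (fieldsLinear g '' (Submodule.span ℝ S : Set g))
      = (Submodule.span ℝ ((fun X : g => inCoords Φ (X : AnalyticVF U)) '' S) : Set _) :=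
    fun S => by
    have h := Submodule.map_span ((inCoordsLinear Φ).comp (fieldsLinear g)) S
    rw [image_image]
    exact congrArg (fun N : Submodule ℝ (Plane → Plane) => (N : Set (Plane → Plane))) h
  refine ⟨Φ, φ, fun z hz => (hΦP hz).1, ⟨hΦne, fun z hz => hPU z (hΦP hz), ?_, hΦsymm, hφ, hφ2,
    ?_, ?_⟩, hV0, hV1, hV2⟩
  · rw [show ⇑Φ = fun z => (a z, y z) from funext hΦ]
    exact fun z hz => (han _ z (hΦP hz)).prod (hya z (hΦP hz))
  · rw [commutatorFieldsOf_eq_image, hspan, himage]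
    simp only [image_insert_eq, image_singleton]
    rw [hV0, hV1, hV2]
  · rw [fieldsOf_eq_image, hspan', himage]
    simp only [image_insert_eq, image_singleton]
    rw [hE, hV0, hV1, hV2]

end Algebra

theorem theorem4p1
    (U : TopologicalSpace.Opens Plane) (hU : IsConnected (U : Set Plane))
    (g : LieSubalgebra ℝ (AnalyticVF U))
    (hdim : Module.finrank ℝ g = 4)
    (hrank : HasRank (fieldsOf g) (U : Set Plane) 1)
    (habel : IsLieAbelian (commutatorIdeal g))
    (heig : ∃ (q : g) (c : ℝ), c ≠ 0 ∧
      Module.finrank ℝ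
        ((LieModule.toEnd ℝ g (commutatorIdeal g) q).maxGenEigenspace c) = 3) :
    -- canonical coordinates, adapted to any basis of `g'`, near every point of a dense open set
    (Module.finrank ℝ (commutatorIdeal g) = 3 ∧
      ∀ v : Module.Basis (Fin 3) ℝ (commutatorIdeal g),
        ∃ W : Set Plane, IsOpen W ∧ W ⊆ U ∧ (U : Set Plane) ⊆ closure W ∧
          ∀ p ∈ W, ∃ (Φ : OpenPartialHomeomorph Plane Plane) (φ : ℝ → ℝ),
            p ∈ Φ.source ∧ IsCanonicalChart g Φ φ ∧
            inCoords Φ ((v 0 : g) : AnalyticVF U) = vertical Φ.target (fun _ _ => 1) ∧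
            inCoords Φ ((v 1 : g) : AnalyticVF U) = vertical Φ.target (fun x _ => x) ∧
            inCoords Φ ((v 2 : g) : AnalyticVF U) = vertical Φ.target (fun x _ => φ x)) ∧
    -- orbits and invariant hypersurfaces in the jet space, in any such coordinates
    (∀ (Φ : OpenPartialHomeomorph Plane Plane) (φ : ℝ → ℝ), IsCanonicalChart g Φ φ →
      GenericOrbits (prolongedFields g Φ) {j : Jet3 | j.base ∈ Φ.target}
        {(x, y, y₁, y₂, y₃) : Jet3 | (x, y) ∈ Φ.target ∧
          y₂ * iteratedDeriv 3 φ x - iteratedDeriv 2 φ x * y₃ ≠ 0} 4 ∧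
      ∀ (D : Set Jet2) (f : Jet2 → ℝ), IsOpen D → (∀ i ∈ D, i.base ∈ Φ.target) →
        (IsInvariantSet (prolongedFields g Φ) {j : Jet3 | j.toJet2 ∈ D} (hypersurface D f) ↔
          ∀ x y y₁ y₂ : ℝ, (x, y, y₁, y₂) ∈ D →
            f (x, y, y₁, y₂) = iteratedDeriv 3 φ x / iteratedDeriv 2 φ x * y₂)) := by

  obtain ⟨q, c, hc, hq⟩ := heig
  refine ⟨⟨finrank_derived_eq_three hdim habel hq, fun v => ?_⟩, fun Φ φ hΦ => ?_⟩
  · -- the union of the domains of all adapted charts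
    refine ⟨{p | ∃ (Φ : OpenPartialHomeomorph Plane Plane) (φ : ℝ → ℝ),
      p ∈ Φ.source ∧ IsCanonicalChart g Φ φ ∧
      inCoords Φ ((v 0 : g) : AnalyticVF U) = vertical Φ.target (fun _ _ => 1) ∧
      inCoords Φ ((v 1 : g) : AnalyticVF U) = vertical Φ.target (fun x _ => x) ∧
      inCoords Φ ((v 2 : g) : AnalyticVF U) = vertical Φ.target (fun x _ => φ x)},
      ?_, ?_, ?_, fun p hp => hp⟩
    · refine isOpen_iff_mem_nhds.2 ?_
      rintro p ⟨Φ, φ, hp, h⟩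
      filter_upwards [Φ.open_source.mem_nhds hp] with p' hp' using ⟨Φ, φ, hp', h⟩
    · rintro p ⟨Φ, φ, hp, h, -⟩
      exact h.source_subset hp
    · refine fun p hp => mem_closure_iff.2 fun O hO hpO => ?_
      obtain ⟨Φ, φ, hΦO, h⟩ := exists_canonicalChart hU hdim hrank habel hc hq v
        (hO.inter U.isOpen) ⟨p, hpO, hp⟩ inter_subset_right
      obtain ⟨p', hp'⟩ := h.1.source_nonempty
      exact ⟨p', (hΦO hp').1, Φ, φ, hp', h⟩
  · have h := hΦ.isProlongedCanonical
    have hne : Φ.target.Nonempty := hΦ.source_nonempty.imp' Φ fun _ hz => Φ.map_source hz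
    exact ⟨h.genericOrbits hne, fun D f _ hD => h.isInvariantSet_hypersurface_iff hD f⟩
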